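/- **Theorem 1.3** (Landau-type theorem). Let $n\ge 3$, $\alpha<1$, let $\sigma$ be the normalized surface measure on the unit sphere $\mathbb S^{n-1}\subset\mathbb R^n$, $\mathbb B^n(r)=\{x\in\mathbb R^n:|x|<r\}$ and $\mathbb B^n=\mathbb B^n(1)$. For $\phi\in L^\infty(\mathbb S^{n-1},\mathbb R^n)$ and $x\in\mathbb B^n$ put $$P_\alpha[\phi](x)=C_{n,\alpha}\int_{\mathbb S^{n-1}}\frac{(1-|x|^2)^{1-\alpha}}{|x-\zeta|^{n-\alpha}}\,\phi(\zeta)\,d\sigma(\zeta),\qquad C_{n,\alpha}=\frac{\Gamma(\frac{n-\alpha}2)\,\Gamma(1-\frac\alpha2)}{\Gamma(\frac n2)\,\Gamma(1-\alpha)} .$$ Let $$g(r)=\frac{2(1+r^2)^{\frac{n+2-\alpha}2}-(1-r)^{n+2-\alpha}-(1-r^2)^{1-\alpha}}{r}\quad(0<r<1),\qquad g(0)=n+2-\alpha,$$ and, with $F_1(t)={}_2F_1\big(\frac\alpha2,\frac{n+\alpha}2-1;\frac n2;t^2\big)$ and $F_2(t)={}_2F_1\big(\frac\alpha2-1,\frac{n+\alpha}2-2;\frac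 n2;t^2\big)$, let for $0\le r<1$ $$G(r)=\frac{2(1-\alpha)C_{n,\alpha}}{1-r^2}\max_{0\le t\le r}F_1(t)+\frac{(n-\alpha)C_{n,\alpha}}{(1-r^2)^2}\max_{0\le t\le r}F_2(t)+\frac{(n-\alpha)C_{n,\alpha}}{(1-r^2)^{3-\alpha}}\max_{0\le t\le r}\big(F_2(t)\,g(t)\big).$$ Let $M>0$, let $\phi\in L^\infty(\mathbb S^{n-1},\mathbb R^n)$ with $\|\phi\|_{L^\infty(\mathbb S^{n-1},\mathbb R^n)}\le M$, let $u=P_\alpha[\phi]$ in $\mathbb B^n$, and suppose that $u(0)=0$ and $J_u(0)=\det Du(0)=1$. Then the equation $$M^n\,r\,G(r)=\left(\frac{\sqrt\pi\;\Gamma(\frac{n+1}2)}{(n-\alpha)\,C_{n,\alpha}\,\Gamma(\frac n2)}\right)^{n-1}$$ has a smallest root $r_0$ in $(0,1)$, $u$ is univalent (injective) in $\mathbb B^n(r_0)$, and $u(\mathbb B^n(r_0))$ contains the ball $\mathbb B^n(R_0)$, where $R_0=\frac M2\,r_0^2\,G(r_0)$. -/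

import Mathlib

open MeasureTheory Metric Set
open scoped ENNReal

noncomputable section

namespace AlphaHarmonic

/-- The normalized surface measure `σ` on the unit sphere of `ℝⁿ`, so that `σ(𝕊ⁿ⁻¹) = 1`. -/
def sphereMeasure (n : ℕ) : Measure (sphere (0 : EuclideanSpace ℝ (Fin n)) 1) :=
  ((volume : Measure (EuclideanSpace ℝ (Fin n))).toSphere univ)⁻¹ •
    (volume : Measure (EuclideanSpace ℝ (Fin n))).toSphere

/-- The constant `C_{n,α} = Γ((n-α)/2) Γ(1-α/2) / (Γ(n/2) Γ(1-α))`. -/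
def normConst (n : ℕ) (α : ℝ) : ℝ :=
  Real.Gamma ((n - α) / 2) * Real.Gamma (1 - α / 2) /
    (Real.Gamma (n / 2) * Real.Gamma (1 - α))

/-- The Poisson–Szegő kernel `P_α(x, ζ) = C_{n,α} (1-|x|²)^{1-α} / |x-ζ|^{n-α}`. -/
def poissonKernel {n : ℕ} (α : ℝ) (x ζ : EuclideanSpace ℝ (Fin n)) : ℝ :=
  normConst n α * ((1 - ‖x‖ ^ 2) ^ (1 - α) / ‖x - ζ‖ ^ ((n : ℝ) - α))

/-- The Poisson–Szegő integral `P_α[φ](x) = ∫ P_α(x, ζ) φ(ζ) dσ(ζ)`; it is used for `|x| < 1`. -/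
def poissonIntegral {n : ℕ} (α : ℝ)
    (φ : sphere (0 : EuclideanSpace ℝ (Fin n)) 1 → EuclideanSpace ℝ (Fin n))
    (x : EuclideanSpace ℝ (Fin n)) : EuclideanSpace ℝ (Fin n) :=
  ∫ ζ, poissonKernel α x (ζ : EuclideanSpace ℝ (Fin n)) • φ ζ ∂(sphereMeasure n)

/-- The Jacobian determinant `J_u(x) = det Du(x)`. -/
def jacobian {n : ℕ} (u : EuclideanSpace ℝ (Fin n) → EuclideanSpace ℝ (Fin n))
    (x : EuclideanSpace ℝ (Fin n)) : ℝ :=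
  (fderiv ℝ u x).det

/-- The auxiliary function `g` on `[0, 1)`. -/
def g (n : ℕ) (α r : ℝ) : ℝ :=
  if r = 0 then (n : ℝ) + 2 - α
  else (2 * (1 + r ^ 2) ^ (((n : ℝ) + 2 - α) / 2) - (1 - r) ^ ((n : ℝ) + 2 - α)
    - (1 - r ^ 2) ^ (1 - α)) / r

/-- `F₁(t) = ₂F₁(α/2, (n+α)/2 - 1; n/2; t²)`. -/
def hyperF₁ (n : ℕ) (α t : ℝ) : ℝ :=
  ordinaryHypergeometric (α / 2) (((n : ℝ) + α) / 2 - 1) ((n : ℝ) / 2) (t ^ 2)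

/-- `F₂(t) = ₂F₁(α/2 - 1, (n+α)/2 - 2; n/2; t²)`. -/
def hyperF₂ (n : ℕ) (α t : ℝ) : ℝ :=
  ordinaryHypergeometric (α / 2 - 1) (((n : ℝ) + α) / 2 - 2) ((n : ℝ) / 2) (t ^ 2)

/-- The function `G` on `[0, 1)`. Here `t` stands for `|x|`, which runs through `[0, r]`; the
functions maximized are continuous on `[0, r]`, so that `sSup` is the maximum. -/
def G (n : ℕ) (α r : ℝ) : ℝ :=
  2 * (1 - α) * normConst n α * sSup (hyperF₁ n α '' Icc 0 r) * (1 / (1 - r ^ 2))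
  + ((n : ℝ) - α) * normConst n α * sSup (hyperF₂ n α '' Icc 0 r) * (1 / (1 - r ^ 2) ^ 2)
  + ((n : ℝ) - α) * normConst n α * sSup ((fun t => hyperF₂ n α t * g n α t) '' Icc 0 r)
      * (1 / (1 - r ^ 2) ^ (3 - α))

end AlphaHarmonic

end

noncomputable section

namespace AlphaHarmonic

-- Differentiation under the integral writes `Du(x)` as the mean over the sphere of rank-one maps
-- built from `φ` and the gradient of the kernel. At the origin this gradient is `(n - α) C ζ`, and
-- the mean of `|⟨v, ζ⟩|` is explicit; hence `‖Du(0)‖ ≤ M / c`, where `c ^ (n - 1)` is the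
-- right-hand side of the equation. Since `det Du(0) = 1`, Hadamard's inequality turns this upper
-- bound into a lower one: `|Du(0) v| ≥ (c / M) ^ (n - 1)` for every unit vector `v`.
--
-- Away from the origin `‖Du(x) - Du(0)‖ ≤ M |x| G(|x|)`, and `G` is nondecreasing, so on the ball
-- of radius `r₀` the deviation is at most `K |x|` with `K = M G(r₀)`. The equation says precisely
-- that `K r₀ = (c / M) ^ (n - 1)`: inside the ball the deviation stays strictly below the lower
-- bound for `Du(0)`. Injectivity then follows from the mean value inequality. Integration along
-- radii together with a connectedness argument gives the covered ball, of radius `K r₀² / 2`. The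
-- root exists and is unique because `r G(r)` is continuous, strictly increasing, zero at `0` and
-- unbounded near `1`.
--
-- The bound by `G` comes from splitting the difference of kernel gradients into three vectors. The
-- first two need spherical means of powers of `|x - ζ|`, which become hypergeometric through the
-- density of one coordinate, an inversion and a quadratic transformation. The third needs the mean
-- of `|A |x - ζ| ^ (-(n + 2 - α)) - 1|` with `A = (1 - |x|²) ^ (1 - α)`. That is reduced to `A =
-- 1`, then to the uniform density by a single-crossing argument, and finally to an elementary
-- inequality proved with Bernoulli's.

local notation "𝔼" n => EuclideanSpace ℝ (Fin n)

/-! ### Gaussian integrals and the moments of a coordinate on the sphere -/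

/-- Integration of a function of one coordinate against the Gaussian weight. -/
theorem integral_coord_mul_exp {n : ℕ} (i : Fin n) (f : ℝ → ℝ) :
    ∫ x : 𝔼 n, f (x i) * Real.exp (-‖x‖ ^ 2) =
      (∫ t, f t * Real.exp (-t ^ 2)) * (Real.sqrt Real.pi) ^ (n - 1) := by
  have h1 := (EuclideanSpace.volume_preserving_symm_measurableEquiv_toLp (Fin n)).integral_comp
    (MeasurableEquiv.measurableEmbedding _)
    (fun y : Fin n → ℝ => ∏ j, (if j = i then fun t => f t * Real.exp (-t ^ 2)
      else fun t => Real.exp (-t ^ 2)) (y j))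
  rw [integral_fintype_prod_volume_eq_prod (f := fun j : Fin n => (if j = i then
    fun t => f t * Real.exp (-t ^ 2) else fun t => Real.exp (-t ^ 2)))] at h1
  have hg : ∫ t : ℝ, Real.exp (-t ^ 2) = Real.sqrt Real.pi := by
    simpa using integral_gaussian 1
  have h2 : ∏ j : Fin n, ∫ t, (if j = i then
      fun t => f t * Real.exp (-t ^ 2) else fun t => Real.exp (-t ^ 2)) t =
      (∫ t, f t * Real.exp (-t ^ 2)) * (Real.sqrt Real.pi) ^ (n - 1) := by
    rw [← Finset.mul_prod_erase _ _ (Finset.mem_univ i), if_pos rfl]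
    congr 1
    rw [Finset.prod_congr rfl (g := fun _ => Real.sqrt Real.pi)]
    · simp
    · intro j hj
      rw [if_neg (Finset.ne_of_mem_erase hj), hg]
  rw [← h2, ← h1]
  congr 1
  ext x
  rw [← Finset.mul_prod_erase _ _ (Finset.mem_univ i), if_pos rfl]
  rw [Finset.prod_congr rfl (g := fun j => Real.exp (-(x j) ^ 2)),
    EuclideanSpace.norm_sq_eq, ← Finset.add_sum_erase _ _ (Finset.mem_univ i), neg_add,
    Real.exp_add, ← Finset.sum_neg_distrib, Real.exp_sum]
  · simp [mul_assoc]
  · intro j hj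
    rw [if_neg (Finset.ne_of_mem_erase hj)]
    rfl

theorem exists_orthonormalBasis_apply_eq {n : ℕ} (i : Fin n) {v : 𝔼 n} (hv : ‖v‖ = 1) :
    ∃ b : OrthonormalBasis (Fin n) ℝ (𝔼 n), b i = v := by
  have ho : Orthonormal ℝ (({i} : Set (Fin n)).domRestrict (fun _ : Fin n => v)) := by
    constructor
    · intro _; exact hv
    · intro a b hab; exact absurd (Subsingleton.elim a b) hab
  obtain ⟨b, hb⟩ := ho.exists_orthonormalBasis_extension_of_card_eq (by simp)
  exact ⟨b, hb i rfl⟩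

/-- The Gaussian weight is rotation invariant, so `v` may be rotated onto a coordinate axis. -/
theorem integral_inner_mul_exp {n : ℕ} (hn : 0 < n) {v : 𝔼 n} (hv : ‖v‖ = 1) (f : ℝ → ℝ) :
    ∫ x : 𝔼 n, f (inner ℝ v x) * Real.exp (-‖x‖ ^ 2) =
      (∫ t, f t * Real.exp (-t ^ 2)) * (Real.sqrt Real.pi) ^ (n - 1) := by
  set i : Fin n := ⟨0, hn⟩
  obtain ⟨b, hbi⟩ := exists_orthonormalBasis_apply_eq i hv
  rw [← integral_coord_mul_exp i f,
    ← b.measurePreserving_repr.integral_comp b.repr.toHomeomorph.measurableEmbedding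
      (fun x => f (x i) * Real.exp (-‖x‖ ^ 2))]
  simp [OrthonormalBasis.repr_apply_apply, hbi]

/-- Polar coordinates for the product of a positively homogeneous function and a Gaussian. -/
theorem integral_homogeneous_mul_exp {n : ℕ} (hn : 0 < n) (d : ℕ) (F : (𝔼 n) → ℝ)
    (hF : ∀ (t : ℝ) (x : 𝔼 n), 0 < t → F (t • x) = t ^ d * F x) :
    ∫ x : 𝔼 n, F x * Real.exp (-‖x‖ ^ 2) =
      (∫ ζ, F ζ ∂(volume : Measure (𝔼 n)).toSphere) * (Real.Gamma ((n + d) / 2) / 2) := by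
  have : Nonempty (Fin n) := ⟨⟨0, hn⟩⟩
  have hrad : ∫ r : Ioi (0 : ℝ), (r : ℝ) ^ d * Real.exp (-(r : ℝ) ^ 2)
      ∂(Measure.volumeIoiPow (n - 1)) = Real.Gamma ((n + d) / 2) / 2 := by
    simp only [Measure.volumeIoiPow, ENNReal.ofReal]
    rw [integral_withDensity_eq_integral_smul ((measurable_subtype_coe.pow_const _).real_toNNReal),
      integral_subtype_comap measurableSet_Ioi fun a : ℝ ↦
        Real.toNNReal (a ^ (n - 1)) • (a ^ d * Real.exp (-a ^ 2))]
    have h := integral_rpow_mul_exp_neg_rpow (p := 2) (q := (n + d - 1 : ℝ)) (by norm_num)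
      (by have : (1 : ℝ) ≤ n := by exact_mod_cast hn
          have : (0 : ℝ) ≤ d := by positivity
          linarith)
    rw [show ((n + d - 1 + 1) / 2 : ℝ) = (n + d) / 2 by ring] at h
    rw [show Real.Gamma ((n + d) / 2) / 2 = 1 / 2 * Real.Gamma ((n + d) / 2) by ring, ← h]
    refine setIntegral_congr_fun measurableSet_Ioi fun x hx => ?_
    have hx' : (0 : ℝ) < x := hx
    simp only [NNReal.smul_def, Real.coe_toNNReal _ (pow_nonneg hx'.le _), smul_eq_mul]
    have : ((n : ℝ) + d - 1) = ((n - 1 + d : ℕ) : ℝ) := by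
      push_cast [Nat.cast_sub hn]; ring
    rw [this, Real.rpow_natCast, pow_add]
    norm_num [mul_assoc]
  rw [← hrad]
  have h1 : ∫ x : 𝔼 n, F x * Real.exp (-‖x‖ ^ 2) =
      ∫ x : ({(0)}ᶜ : Set (𝔼 n)), F (x : 𝔼 n) * Real.exp (-‖(x : 𝔼 n)‖ ^ 2)
        ∂((volume : Measure (𝔼 n)).comap (Subtype.val : ({(0)}ᶜ : Set (𝔼 n)) → (𝔼 n))) := by
    rw [integral_subtype_comap (measurableSet_singleton _).compl
      fun x : 𝔼 n ↦ F x * Real.exp (-‖x‖ ^ 2), restrict_compl_singleton]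
  have h2 := (volume : Measure (𝔼 n)).measurePreserving_homeomorphUnitSphereProd.integral_comp
      (Homeomorph.measurableEmbedding _)
      (fun y => F (y.1 : 𝔼 n) * ((y.2 : ℝ) ^ d * Real.exp (-(y.2 : ℝ) ^ 2)))
  rw [integral_prod_mul (fun y : sphere (0 : 𝔼 n) 1 => F y)
    (fun r : Ioi (0 : ℝ) => (r : ℝ) ^ d * Real.exp (-(r : ℝ) ^ 2))] at h2
  rw [h1]
  simp only [finrank_euclideanSpace, Fintype.card_fin] at h2
  rw [← h2]
  congr 1
  ext x
  have hx : (0 : ℝ) < ‖(x : 𝔼 n)‖ := norm_pos_iff.2 x.2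
  simp only [homeomorphUnitSphereProd_apply_snd_coe, homeomorphUnitSphereProd_apply_fst_coe]
  have hd : (‖(x : 𝔼 n)‖⁻¹) ^ d * ‖(x : 𝔼 n)‖ ^ d = 1 := by
    rw [← mul_pow, inv_mul_cancel₀ hx.ne', one_pow]
  rw [hF _ _ (inv_pos.2 hx)]
  linear_combination (-F x * Real.exp (-‖(x : 𝔼 n)‖ ^ 2)) * hd

/-- The Gaussian integral is computed twice, in Cartesian and in polar coordinates. -/
theorem toSphere_univ_toReal {n : ℕ} (hn : 0 < n) :
    (volume : Measure (𝔼 n)).toSphere.real univ * (Real.Gamma (n / 2) / 2) =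
      (Real.sqrt Real.pi) ^ n := by
  have h := integral_homogeneous_mul_exp hn 0 (fun _ => 1) (by simp)
  have h' := integral_coord_mul_exp (⟨0, hn⟩ : Fin n) (fun _ => 1)
  have hg : ∫ t : ℝ, Real.exp (-t ^ 2) = Real.sqrt Real.pi := by
    simpa using integral_gaussian 1
  rw [h'] at h
  simp only [one_mul, hg, integral_const, smul_eq_mul, mul_one, Nat.cast_zero, add_zero] at h
  rw [← h, ← pow_succ', Nat.sub_add_cancel hn]

instance isProbabilityMeasure_sphereMeasure {n : ℕ} [NeZero n] :
    IsProbabilityMeasure (sphereMeasure n) := by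
  have : Nonempty (Fin n) := ⟨0⟩
  constructor
  rw [sphereMeasure, Measure.smul_apply, smul_eq_mul]
  exact ENNReal.inv_mul_cancel (by
    rw [Ne, Measure.measure_univ_eq_zero]; exact Measure.toSphere_ne_zero (volume : Measure (𝔼 n))) (measure_ne_top _ _)

theorem integral_sphereMeasure {n : ℕ} (F : sphere (0 : 𝔼 n) 1 → ℝ) :
    ∫ ζ, F ζ ∂(sphereMeasure n) = ((volume : Measure (𝔼 n)).toSphere.real univ)⁻¹ *
      ∫ ζ, F ζ ∂(volume : Measure (𝔼 n)).toSphere := by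
  rw [sphereMeasure, integral_smul_measure, smul_eq_mul, ENNReal.toReal_inv, Measure.real]

/-- The mean over the sphere of a homogeneous function of one coordinate. -/
theorem integral_sphere_homogeneous {n : ℕ} (hn : 0 < n) {v : 𝔼 n} (hv : ‖v‖ = 1) (d : ℕ)
    (f : ℝ → ℝ) (hf : ∀ t x, 0 < t → f (t * x) = t ^ d * f x) :
    ∫ ζ, f (inner ℝ v (ζ : 𝔼 n)) ∂(sphereMeasure n) =
      (∫ t, f t * Real.exp (-t ^ 2)) * Real.Gamma (n / 2) /
        (Real.sqrt Real.pi * Real.Gamma ((n + d) / 2)) := by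
  have h := integral_homogeneous_mul_exp hn d (fun x => f (inner ℝ v x)) (by
    intro t x ht; simp only [inner_smul_right]; exact hf _ _ ht)
  rw [integral_inner_mul_exp hn hv] at h
  -- The case of degree `0` supplies the area by which the measure is normalized.
  have h0 := toSphere_univ_toReal hn
  have hn' : (0 : ℝ) < n := by exact_mod_cast hn
  have hG : 0 < Real.Gamma (n / 2 : ℝ) := Real.Gamma_pos_of_pos (by positivity)
  have hG' : 0 < Real.Gamma ((n + d) / 2 : ℝ) := Real.Gamma_pos_of_pos (by positivity)
  have hp : 0 < Real.sqrt Real.pi := Real.sqrt_pos.2 Real.pi_pos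
  have hS : (volume : Measure (𝔼 n)).toSphere.real univ ≠ 0 := by
    intro h00; rw [h00, zero_mul] at h0; exact (pow_pos hp n).ne h0
  rw [integral_sphereMeasure]
  obtain ⟨m, rfl⟩ : ∃ m, n = m + 1 := ⟨n - 1, by omega⟩
  rw [eq_div_iff (by positivity), inv_mul_eq_div, div_mul_eq_mul_div, div_eq_iff hS]
  simp only [Nat.add_sub_cancel] at h
  have e : Real.sqrt Real.pi ^ (m + 1) = Real.sqrt Real.pi ^ m * Real.sqrt Real.pi := pow_succ _ _
  have hpm : Real.sqrt Real.pi ^ m ≠ 0 := (pow_pos hp m).ne'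
  apply mul_left_cancel₀ hpm
  rw [e] at h0
  linear_combination (-(2 : ℝ) * Real.sqrt Real.pi) * Real.sqrt Real.pi ^ m * h - 2 * (∫ t, f t * Real.exp (-t ^ 2)) * h0 * Real.sqrt Real.pi ^ m

theorem integral_abs_pow_mul_exp (k : ℕ) :
    ∫ t : ℝ, |t| ^ k * Real.exp (-t ^ 2) = Real.Gamma ((k + 1) / 2) := by
  have h := integral_comp_abs (f := fun t : ℝ => t ^ k * Real.exp (-t ^ 2))
  simp only [sq_abs] at h
  rw [h]
  have h1 := integral_rpow_mul_exp_neg_rpow (p := 2) (q := (k : ℝ)) (by norm_num)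
    (by have : (0 : ℝ) ≤ k := by positivity
        linarith)
  have h2 : ∫ x in Ioi (0 : ℝ), x ^ k * Real.exp (-x ^ 2) =
      ∫ x in Ioi (0 : ℝ), x ^ (k : ℝ) * Real.exp (-x ^ (2 : ℝ)) := by
    refine setIntegral_congr_fun measurableSet_Ioi fun x hx => ?_
    norm_num
  rw [h2, h1]
  ring

theorem integral_sphere_abs_pow {n : ℕ} (hn : 0 < n) {v : 𝔼 n} (hv : ‖v‖ = 1) (k : ℕ) :
    ∫ ζ, |inner ℝ v (ζ : 𝔼 n)| ^ k ∂(sphereMeasure n) =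
      Real.Gamma ((k + 1) / 2) * Real.Gamma (n / 2) /
        (Real.sqrt Real.pi * Real.Gamma ((n + k) / 2)) := by
  rw [integral_sphere_homogeneous hn hv k (fun t => |t| ^ k)
    (by intro t x ht; rw [abs_mul, mul_pow, abs_of_pos ht]), integral_abs_pow_mul_exp]

theorem integral_sphere_abs {n : ℕ} (hn : 0 < n) {v : 𝔼 n} (hv : ‖v‖ = 1) :
    ∫ ζ, |inner ℝ v (ζ : 𝔼 n)| ∂(sphereMeasure n) =
      Real.Gamma (n / 2) / (Real.sqrt Real.pi * Real.Gamma ((n + 1) / 2)) := by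
  have h := integral_sphere_abs_pow hn hv 1
  simpa using h

theorem integral_sphere_pow_odd {n : ℕ} (hn : 0 < n) {v : 𝔼 n} (hv : ‖v‖ = 1) {k : ℕ}
    (hk : Odd k) : ∫ ζ, (inner ℝ v (ζ : 𝔼 n)) ^ k ∂(sphereMeasure n) = 0 := by
  rw [integral_sphere_homogeneous hn hv k (fun t => t ^ k) (by intro t x _; rw [mul_pow])]
  have h : ∫ t : ℝ, t ^ k * Real.exp (-t ^ 2) = 0 := by
    have h1 := integral_neg_eq_self (fun t : ℝ => t ^ k * Real.exp (-t ^ 2)) volume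
    simp only [hk.neg_pow, neg_mul, integral_neg, even_two.neg_pow] at h1
    linarith
  rw [h]; simp

/-- For even `k` this is the functional equation of Gamma; for odd `k` both sides vanish. The form
matches `integral_pow_mul_weight_add_two`. -/
theorem integral_sphere_pow_add_two {n : ℕ} (hn : 0 < n) {v : 𝔼 n} (hv : ‖v‖ = 1) (k : ℕ) :
    ((k : ℝ) + n) * ∫ ζ, (inner ℝ v (ζ : 𝔼 n)) ^ (k + 2) ∂(sphereMeasure n) =
      (k + 1) * ∫ ζ, (inner ℝ v (ζ : 𝔼 n)) ^ k ∂(sphereMeasure n) := by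
  rcases Nat.even_or_odd k with hk | hk
  · have hk2 : Even (k + 2) := hk.add even_two
    have h1 := integral_sphere_abs_pow hn hv k
    have h2 := integral_sphere_abs_pow hn hv (k + 2)
    simp only [hk.pow_abs] at h1
    simp only [hk2.pow_abs] at h2
    rw [h1, h2]
    have hn' : (0 : ℝ) < n := by exact_mod_cast hn
    have e1 : Real.Gamma (((k + 2 : ℕ) + 1) / 2 : ℝ) = ((k + 1) / 2 : ℝ) *
        Real.Gamma ((k + 1) / 2 : ℝ) := by
      rw [← Real.Gamma_add_one (by positivity)]; congr 1; push_cast; ring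
    have e2 : Real.Gamma ((n + (k + 2 : ℕ)) / 2 : ℝ) = ((n + k) / 2 : ℝ) *
        Real.Gamma ((n + k) / 2 : ℝ) := by
      rw [← Real.Gamma_add_one (by positivity)]; congr 1; push_cast; ring
    have hG' : 0 < Real.Gamma ((n + k) / 2 : ℝ) := Real.Gamma_pos_of_pos (by positivity)
    have hp : 0 < Real.sqrt Real.pi := Real.sqrt_pos.2 Real.pi_pos
    rw [e1, e2]
    field_simp
    ring
  · rw [integral_sphere_pow_odd hn hv hk, integral_sphere_pow_odd hn hv (hk.add_even even_two)]
    simp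

/-! ### The density of a coordinate -/

/-- The (unnormalized) density of a coordinate of a uniform point on the sphere. -/
def weight (n : ℕ) (s : ℝ) : ℝ := (1 - s ^ 2) ^ (((n : ℝ) - 3) / 2)

theorem continuous_weight {n : ℕ} (hn : 3 ≤ n) : Continuous (weight n) := by
  have hn' : (3 : ℝ) ≤ n := by exact_mod_cast hn
  unfold weight
  exact (by fun_prop : Continuous fun s : ℝ => 1 - s ^ 2).rpow_const fun _ => Or.inr (by linarith)

theorem weight_nonneg {n : ℕ} {s : ℝ} (hs : s ∈ Icc (-1 : ℝ) 1) : 0 ≤ weight n s :=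
  Real.rpow_nonneg (by nlinarith [hs.1, hs.2]) _

theorem weight_neg (n : ℕ) (s : ℝ) : weight n (-s) = weight n s := by simp [weight]

theorem integral_weight_pos {n : ℕ} (hn : 3 ≤ n) : 0 < ∫ s in (-1 : ℝ)..1, weight n s := by
  apply intervalIntegral.intervalIntegral_pos_of_pos_on
    ((continuous_weight hn).intervalIntegrable _ _) _ (by norm_num)
  intro s hs
  exact Real.rpow_pos_of_pos (by nlinarith [hs.1, hs.2]) _

theorem integral_pow_mul_weight_odd {n k : ℕ} (hk : Odd k) :
    ∫ s in (-1 : ℝ)..1, s ^ k * weight n s = 0 := by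
  have h := intervalIntegral.integral_comp_neg (a := -1) (b := 1) (fun s : ℝ => s ^ k * weight n s)
  simp only [hk.neg_pow, weight_neg, neg_mul, intervalIntegral.integral_neg, neg_neg] at h
  linarith

/-- The derivative of `s ^ (k + 1) * (1 - s ^ 2) ^ ((n - 1) / 2)` is integrated over `[-1, 1]`; the
boundary values vanish. -/
theorem integral_pow_mul_weight_add_two {n : ℕ} (hn : 3 ≤ n) (k : ℕ) :
    ((k : ℝ) + n) * ∫ s in (-1 : ℝ)..1, s ^ (k + 2) * weight n s =
      (k + 1) * ∫ s in (-1 : ℝ)..1, s ^ k * weight n s := by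
  have hn' : (3 : ℝ) ≤ n := by exact_mod_cast hn
  have hw := continuous_weight hn
  have hd : ∀ s ∈ uIcc (-1 : ℝ) 1, HasDerivAt
      (fun s : ℝ => s ^ (k + 1) * (1 - s ^ 2) ^ (((n : ℝ) - 1) / 2))
      ((k + 1) * (s ^ k * weight n s) - (k + n) * (s ^ (k + 2) * weight n s)) s := by
    intro s hs
    rw [uIcc_of_le (by norm_num)] at hs
    have h1 := (((hasDerivAt_id s).pow 2).const_sub 1).rpow_const (p := ((n : ℝ) - 1) / 2)
      (Or.inr (by linarith))
    have h2 := (hasDerivAt_pow (k + 1) s).mul h1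
    refine HasDerivAt.congr_deriv h2 ?_
    have e : (1 - s ^ 2) ^ (((n : ℝ) - 1) / 2) = (1 - s ^ 2) * weight n s := by
      rw [weight]
      rcases eq_or_ne (1 - s ^ 2) 0 with h0 | h0
      · rw [h0, zero_mul, Real.zero_rpow (by linarith)]
      · rw [mul_comm, ← Real.rpow_add_one h0]; congr 1; ring
    have e' : (1 - s ^ 2) ^ (((n : ℝ) - 1) / 2 - 1) = weight n s := by
      rw [weight]; congr 1; ring
    simp only [id_eq, Pi.pow_apply, Nat.add_sub_cancel, Nat.cast_add, Nat.cast_one, e, e']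
    push_cast
    ring
  have hint := intervalIntegral.integral_eq_sub_of_hasDerivAt hd
    (Continuous.intervalIntegrable (by fun_prop) _ _)
  rw [intervalIntegral.integral_sub (Continuous.intervalIntegrable (by fun_prop) _ _)
    (Continuous.intervalIntegrable (by fun_prop) _ _), intervalIntegral.integral_const_mul,
    intervalIntegral.integral_const_mul] at hint
  have hz : (0 : ℝ) ^ (((n : ℝ) - 1) / 2) = 0 := Real.zero_rpow (by linarith)
  norm_num [hz] at hint
  linarith

/-- Both moment sequences obey the same two-step recursion and agree at `k = 0` and `k = 1`. -/
theorem integral_sphere_pow_eq {n : ℕ} (hn : 3 ≤ n) {v : 𝔼 n} (hv : ‖v‖ = 1) (k : ℕ) :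
    (∫ s in (-1 : ℝ)..1, weight n s) * ∫ ζ, (inner ℝ v (ζ : 𝔼 n)) ^ k ∂(sphereMeasure n) =
      ∫ s in (-1 : ℝ)..1, s ^ k * weight n s := by
  have : NeZero n := ⟨by omega⟩
  induction k using Nat.strong_induction_on with
  | _ k ih =>
    match k, ih with
    | 0, _ => simp
    | 1, _ =>
      rw [integral_sphere_pow_odd (by omega) hv odd_one, integral_pow_mul_weight_odd odd_one,
        mul_zero]
    | k + 2, ih =>
      have h := ih k (by omega)
      have h1 := integral_sphere_pow_add_two (by omega) hv k
      have h2 := integral_pow_mul_weight_add_two hn k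
      have h3 : (k : ℝ) + n ≠ 0 := by positivity
      apply mul_left_cancel₀ h3
      rw [h2, ← h, mul_left_comm, h1]
      ring

theorem inner_sphere_mem_Icc {n : ℕ} {v : 𝔼 n} (hv : ‖v‖ = 1) (ζ : sphere (0 : 𝔼 n) 1) :
    inner ℝ v (ζ : 𝔼 n) ∈ Icc (-1 : ℝ) 1 := by
  have h := abs_real_inner_le_norm v (ζ : 𝔼 n)
  rw [hv, norm_eq_of_mem_sphere, mul_one] at h
  exact abs_le.1 h

theorem continuous_comp_inner_sphere {n : ℕ} {v : 𝔼 n} (hv : ‖v‖ = 1) {f : ℝ → ℝ}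
    (hf : ContinuousOn f (Icc (-1) 1)) :
    Continuous fun ζ : sphere (0 : 𝔼 n) 1 => f (inner ℝ v (ζ : 𝔼 n)) :=
  hf.comp_continuous (by fun_prop) (inner_sphere_mem_Icc hv)

theorem integrable_comp_inner_sphere {n : ℕ} [NeZero n] {v : 𝔼 n} (hv : ‖v‖ = 1) {f : ℝ → ℝ}
    (hf : ContinuousOn f (Icc (-1) 1)) :
    Integrable (fun ζ : sphere (0 : 𝔼 n) 1 => f (inner ℝ v (ζ : 𝔼 n))) (sphereMeasure n) :=
  (continuous_comp_inner_sphere hv hf).integrable_of_hasCompactSupport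
    (HasCompactSupport.of_compactSpace _)

theorem intervalIntegrable_mul_weight {n : ℕ} (hn : 3 ≤ n) {f : ℝ → ℝ}
    (hf : ContinuousOn f (Icc (-1) 1)) :
    IntervalIntegrable (fun s => f s * weight n s) volume (-1) 1 := by
  apply ContinuousOn.intervalIntegrable
  rw [uIcc_of_le (by norm_num)]
  exact hf.mul (continuous_weight hn).continuousOn

/-- The distribution of a coordinate of a uniform point on the sphere. -/
theorem integral_sphere_eq_integral_weight {n : ℕ} (hn : 3 ≤ n) {v : 𝔼 n} (hv : ‖v‖ = 1)
    {f : ℝ → ℝ} (hf : ContinuousOn f (Icc (-1) 1)) :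
    (∫ s in (-1 : ℝ)..1, weight n s) * ∫ ζ, f (inner ℝ v (ζ : 𝔼 n)) ∂(sphereMeasure n) =
      ∫ s in (-1 : ℝ)..1, f s * weight n s := by
  have : NeZero n := ⟨by omega⟩
  have hκ := integral_weight_pos hn
  set κ := ∫ s in (-1 : ℝ)..1, weight n s with hκdef
  have hpoly : ∀ p : Polynomial ℝ,
      κ * ∫ ζ, p.eval (inner ℝ v (ζ : 𝔼 n)) ∂(sphereMeasure n) =
        ∫ s in (-1 : ℝ)..1, p.eval s * weight n s := by
    intro p
    induction p using Polynomial.induction_on' with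
    | add p q hp hq =>
      simp only [Polynomial.eval_add, add_mul]
      rw [integral_add (integrable_comp_inner_sphere hv p.continuous.continuousOn)
        (integrable_comp_inner_sphere hv q.continuous.continuousOn), mul_add, hp, hq,
        intervalIntegral.integral_add (intervalIntegrable_mul_weight hn p.continuous.continuousOn)
          (intervalIntegrable_mul_weight hn q.continuous.continuousOn)]
    | monomial k a =>
      simp only [Polynomial.eval_monomial, mul_assoc]
      rw [integral_const_mul, intervalIntegral.integral_const_mul,
        ← integral_sphere_pow_eq hn hv k]
      ring
  -- Both sides are continuous in `f` for the sup norm, so Weierstrass approximation extends the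
  -- identity from polynomials; each side costs `ε / 2`.
  refine eq_of_abs_sub_le_all fun ε hε => ?_
  obtain ⟨p, hp⟩ := exists_polynomial_near_of_continuousOn (-1) 1 f hf (ε / (2 * κ))
    (by positivity)
  have hpc := p.continuous.continuousOn (s := Icc (-1 : ℝ) 1)
  have h1 : |κ * ∫ ζ, f (inner ℝ v (ζ : 𝔼 n)) ∂(sphereMeasure n) -
      κ * ∫ ζ, p.eval (inner ℝ v (ζ : 𝔼 n)) ∂(sphereMeasure n)| ≤ ε / 2 := by
    rw [← mul_sub, ← integral_sub (integrable_comp_inner_sphere hv hf)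
      (integrable_comp_inner_sphere hv hpc), abs_mul, abs_of_pos hκ]
    have := norm_integral_le_of_norm_le_const (μ := sphereMeasure n)
      (f := fun ζ : sphere (0 : 𝔼 n) 1 => f (inner ℝ v (ζ : 𝔼 n)) - p.eval (inner ℝ v (ζ : 𝔼 n)))
      (C := ε / (2 * κ)) (Filter.Eventually.of_forall fun ζ => by
        rw [Real.norm_eq_abs, abs_sub_comm]
        exact (hp _ (inner_sphere_mem_Icc hv ζ)).le)
    rw [Real.norm_eq_abs] at this
    simp only [probReal_univ, mul_one] at this
    calc _ ≤ κ * (ε / (2 * κ)) := by gcongr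
      _ = ε / 2 := by field_simp
  have h2 : |(∫ s in (-1 : ℝ)..1, f s * weight n s) -
      ∫ s in (-1 : ℝ)..1, p.eval s * weight n s| ≤ ε / 2 := by
    rw [← intervalIntegral.integral_sub (intervalIntegrable_mul_weight hn hf)
      (intervalIntegrable_mul_weight hn hpc)]
    have := intervalIntegral.norm_integral_le_of_norm_le (a := -1) (b := 1) (μ := volume)
      (f := fun s => f s * weight n s - p.eval s * weight n s)
      (g := fun s => ε / (2 * κ) * weight n s) (by norm_num)
      (Filter.Eventually.of_forall fun s hs => by
        have hs' : s ∈ Icc (-1 : ℝ) 1 := ⟨hs.1.le, hs.2⟩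
        rw [← sub_mul, norm_mul, Real.norm_eq_abs, Real.norm_eq_abs, abs_sub_comm,
          abs_of_nonneg (weight_nonneg hs')]
        exact mul_le_mul_of_nonneg_right (hp _ hs').le (weight_nonneg hs'))
      ((continuous_const.mul (continuous_weight hn)).intervalIntegrable _ _)
    rw [intervalIntegral.integral_const_mul, ← hκdef, Real.norm_eq_abs] at this
    calc _ ≤ _ := this
      _ = ε / 2 := by field_simp
  rw [hpoly] at h1
  rw [abs_le] at h1 h2 ⊢
  constructor <;> linarith [h1.1, h1.2, h2.1, h2.2]

/-! ### Spherical means of powers of the distance, and inversion -/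

theorem one_add_sq_sub_pos {r s : ℝ} (hr0 : 0 ≤ r) (hr1 : r < 1) (hs : s ∈ Icc (-1 : ℝ) 1) :
    0 < 1 + r ^ 2 - 2 * r * s := by
  nlinarith [mul_le_mul_of_nonneg_left hs.2 hr0, sq_pos_of_pos (sub_pos.2 hr1)]

theorem continuousOn_one_add_sq_sub_rpow {r : ℝ} (hr0 : 0 ≤ r) (hr1 : r < 1) (l : ℝ) :
    ContinuousOn (fun s : ℝ => (1 + r ^ 2 - 2 * r * s) ^ l) (Icc (-1) 1) :=
  ContinuousOn.rpow_const (by fun_prop) fun _ hs => Or.inl (one_add_sq_sub_pos hr0 hr1 hs).ne'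

/-- The mean over `ζ` in the unit sphere of `|x - ζ| ^ (2 * l)`, where `r = |x|`. -/
def sphereMean (n : ℕ) (l r : ℝ) : ℝ :=
  (∫ s in (-1 : ℝ)..1, weight n s)⁻¹ *
    ∫ s in (-1 : ℝ)..1, (1 + r ^ 2 - 2 * r * s) ^ l * weight n s

theorem integral_sphere_eq_sphereMean {n : ℕ} (hn : 3 ≤ n) {v : 𝔼 n} (hv : ‖v‖ = 1)
    {r : ℝ} (hr0 : 0 ≤ r) (hr1 : r < 1) (l : ℝ) :
    ∫ ζ, (1 + r ^ 2 - 2 * r * inner ℝ v (ζ : 𝔼 n)) ^ l ∂(sphereMeasure n) =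
      sphereMean n l r := by
  rw [sphereMean, ← integral_sphere_eq_integral_weight hn hv
    (continuousOn_one_add_sq_sub_rpow hr0 hr1 l), inv_mul_cancel_left₀ (integral_weight_pos hn).ne']

/-- Inversion: the exponents `l` and `1 - n - l` give proportional means. -/
theorem sphereMean_eq_inversion {n : ℕ} (hn : 3 ≤ n) {r : ℝ} (hr0 : 0 ≤ r) (hr1 : r < 1) (l : ℝ) :
    sphereMean n l r = (1 - r ^ 2) ^ ((n : ℝ) - 1 + 2 * l) * sphereMean n (1 - n - l) r := by
  rcases hr0.eq_or_lt with rfl | hr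
  · simp [sphereMean]
  have hδ : 0 < 1 - r ^ 2 := by nlinarith
  have hn' : (3 : ℝ) ≤ n := by exact_mod_cast hn
  rw [sphereMean, sphereMean, mul_left_comm]
  congr 1
  -- The substitution sends the coordinate of one end of a chord through `x` to that of the other
  -- end. By the power of the point `x`, the two values of `1 + r ^ 2 - 2 * r * s` have product `(1
  -- - r ^ 2) ^ 2`. The endpoints `-1` and `1` are exchanged.
  set φ : ℝ → ℝ := fun t => ((1 + r ^ 2) - (1 - r ^ 2) ^ 2 / (1 + r ^ 2 - 2 * r * t)) / (2 * r)
    with hφ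
  set φ' : ℝ → ℝ := fun t => -((1 - r ^ 2) ^ 2 / (1 + r ^ 2 - 2 * r * t) ^ 2) with hφ'
  have hpos : ∀ t ∈ Icc (-1 : ℝ) 1, 0 < 1 + r ^ 2 - 2 * r * t := fun t ht =>
    one_add_sq_sub_pos hr0 hr1 ht
  have hu : uIcc (-1 : ℝ) 1 = Icc (-1) 1 := uIcc_of_le (by norm_num)
  have hφ1 : φ 1 = -1 := by
    have : 1 + r ^ 2 - 2 * r * 1 = (1 - r) ^ 2 := by ring
    simp only [hφ, this]
    have h1 : (1 - r) ≠ 0 := by linarith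
    field_simp
    ring
  have hφm : φ (-1) = 1 := by
    have : 1 + r ^ 2 - 2 * r * (-1) = (1 + r) ^ 2 := by ring
    simp only [hφ, this]
    have h1 : (1 + r) ≠ 0 := by linarith
    field_simp
    ring
  have hone : ∀ t ∈ Icc (-1 : ℝ) 1, 1 - φ t ^ 2 =
      (1 - t ^ 2) * ((1 - r ^ 2) / (1 + r ^ 2 - 2 * r * t)) ^ 2 := by
    intro t ht
    have h1 := (hpos t ht).ne'
    simp only [hφ]
    generalize hy : 1 + r ^ 2 - 2 * r * t = y at h1
    obtain rfl : t = (1 + r ^ 2 - y) / (2 * r) := by field_simp; linarith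
    field_simp
    ring
  have hmem : φ '' uIcc (-1 : ℝ) 1 ⊆ Icc (-1) 1 := by
    rintro _ ⟨t, ht, rfl⟩
    rw [hu] at ht
    have h0 : 0 ≤ 1 - φ t ^ 2 := by
      rw [hone t ht]
      exact mul_nonneg (by nlinarith [ht.1, ht.2]) (sq_nonneg _)
    exact abs_le.1 (abs_le_one_iff_mul_self_le_one.2 (by nlinarith))
  have hderiv : ∀ t ∈ uIcc (-1 : ℝ) 1, HasDerivAt φ (φ' t) t := by
    intro t ht
    rw [hu] at ht
    have h1 := (hpos t ht).ne'
    have h2 : HasDerivAt (fun t : ℝ => 1 + r ^ 2 - 2 * r * t) (-(2 * r * 1)) t :=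
      ((hasDerivAt_id t).const_mul (2 * r)).const_sub _
    refine (((h2.inv h1).const_mul ((1 - r ^ 2) ^ 2)).const_sub (1 + r ^ 2)
      |>.div_const (2 * r)).congr_deriv ?_
    simp only [hφ']
    field_simp
  have hsub := intervalIntegral.integral_comp_mul_deriv' (a := -1) (b := 1) (f := φ) (f' := φ')
    (g := fun s => (1 + r ^ 2 - 2 * r * s) ^ l * weight n s) hderiv
    (by
      rw [hu]
      exact (ContinuousOn.div (by fun_prop) (by fun_prop)
        fun t ht => pow_ne_zero _ (hpos t ht).ne').neg)
    (((continuousOn_one_add_sq_sub_rpow hr0 hr1 l).mul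
      (continuous_weight hn).continuousOn).mono hmem)
  rw [hφ1, hφm, intervalIntegral.integral_symm (-1) 1] at hsub
  rw [← neg_inj, ← hsub, ← intervalIntegral.integral_const_mul, ← intervalIntegral.integral_neg]
  refine intervalIntegral.integral_congr fun t ht => ?_
  rw [hu] at ht
  have h1 := hpos t ht
  have h2 : 1 + r ^ 2 - 2 * r * φ t = (1 - r ^ 2) ^ 2 / (1 + r ^ 2 - 2 * r * t) := by
    simp only [hφ]; field_simp; ring
  simp only [Function.comp_apply, h2, weight, hone t ht, hφ']
  set y := 1 + r ^ 2 - 2 * r * t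
  have h3 : 0 ≤ 1 - t ^ 2 := by nlinarith [ht.1, ht.2]
  rw [Real.mul_rpow h3 (by positivity), ← Real.rpow_natCast ((1 - r ^ 2) / y) 2,
    ← Real.rpow_mul (by positivity), Real.div_rpow (by positivity) h1.le,
    Real.div_rpow hδ.le h1.le, ← Real.rpow_natCast (1 - r ^ 2) 2, ← Real.rpow_mul hδ.le,
    ← Real.rpow_natCast y 2]
  -- Exponent count: the powers of `1 - r ^ 2` add up to `n - 1 + 2 * l`, and those of `y` leave
  -- exactly `y ^ (1 - n - l)`.
  have e1 : (1 - r ^ 2) ^ ((n : ℝ) - 1 + 2 * l) = (1 - r ^ 2) ^ ((2 : ℕ) * l) *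
      (1 - r ^ 2) ^ ((2 : ℕ) * (((n : ℝ) - 3) / 2)) * (1 - r ^ 2) ^ ((2 : ℕ) : ℝ) := by
    rw [← Real.rpow_add hδ, ← Real.rpow_add hδ]; congr 1; push_cast; ring
  have e2 : y ^ (1 - (n : ℝ) - l) * (y ^ l * y ^ ((2 : ℕ) * (((n : ℝ) - 3) / 2)) *
      y ^ ((2 : ℕ) : ℝ)) = 1 := by
    rw [← Real.rpow_add h1, ← Real.rpow_add h1, ← Real.rpow_add h1]
    convert Real.rpow_zero y using 2
    push_cast; ring
  rw [e1, eq_div_of_mul_eq (by positivity) e2]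
  field_simp

/-! ### Rising factorials and a Chu–Vandermonde sum -/

/-- The rising factorial `(a)_k`. -/
def rising (a : ℝ) (k : ℕ) : ℝ := ∏ i ∈ Finset.range k, (a + i)

@[simp] theorem rising_zero (a : ℝ) : rising a 0 = 1 := by simp [rising]

theorem rising_succ (a : ℝ) (k : ℕ) : rising a (k + 1) = rising a k * (a + k) := by
  simp [rising, Finset.prod_range_succ]

theorem rising_add (a : ℝ) (m k : ℕ) : rising a (m + k) = rising a m * rising (a + m) k := by
  simp [rising, Finset.prod_range_add, add_assoc]

theorem rising_succ' (a : ℝ) (k : ℕ) : rising a (k + 1) = a * rising (a + 1) k := by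
  rw [add_comm, rising_add]; simp [rising_succ]

theorem rising_pos {a : ℝ} (ha : 0 < a) (k : ℕ) : 0 < rising a k :=
  Finset.prod_pos fun _ _ => by positivity

theorem abs_rising_le (a : ℝ) (k : ℕ) : |rising a k| ≤ rising |a| k := by
  rw [rising, Finset.abs_prod]
  exact Finset.prod_le_prod (fun _ _ => abs_nonneg _) fun i _ => by
    simpa using abs_add_le a (i : ℝ)

theorem rising_nonneg {a : ℝ} (ha : 0 ≤ a) (k : ℕ) : 0 ≤ rising a k :=
  Finset.prod_nonneg fun _ _ => by positivity

theorem ascPochhammer_eval_eq_rising (a : ℝ) (k : ℕ) :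
    (ascPochhammer ℝ k).eval a = rising a k := by
  induction k with
  | zero => simp
  | succ k ih => rw [ascPochhammer_succ_eval, ih, rising_succ]

/-- A form of the Chu–Vandermonde identity. -/
theorem sum_choose_mul_rising (N : ℕ) : ∀ b c : ℝ,
    ∑ k ∈ Finset.range (N + 1), (-1) ^ k * (N.choose k : ℝ) * rising b k * rising (c + k) (N - k) =
      rising (c - b) N := by
  induction N with
  | zero => simp
  | succ N ih =>
    intro b c
    -- Pascal's rule splits each term in two; regrouped, neighbouring pieces differ by the factor
    -- `(c + k) - (b + k) = c - b` and leave the sum for `N` with `c + 1`. This is why the induction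
    -- runs over all `b` and `c`.
    have h1 : ∀ k ∈ Finset.range (N + 1), (-1 : ℝ) ^ k * (N.choose k : ℝ) * rising b k *
        rising (c + k) (N + 1 - k) + (-1) ^ (k + 1) * (N.choose k : ℝ) * rising b (k + 1) *
        rising (c + (k + 1 : ℕ)) (N + 1 - (k + 1)) =
        (c - b) * ((-1) ^ k * (N.choose k : ℝ) * rising b k * rising (c + 1 + k) (N - k)) := by
      intro k hk
      have hk' : k ≤ N := Nat.lt_succ_iff.1 (Finset.mem_range.1 hk)
      rw [Nat.succ_sub hk', rising_succ', rising_succ, Nat.add_sub_add_right]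
      push_cast
      rw [show c + (k : ℝ) + 1 = c + 1 + k by ring, show c + ((k : ℝ) + 1) = c + 1 + k by ring]
      ring
    have h2 := Finset.sum_congr rfl h1
    rw [Finset.sum_add_distrib, ← Finset.mul_sum, ih] at h2
    rw [rising_succ', show c - b + 1 = c + 1 - b by ring, ← h2, Finset.sum_range_succ']
    have h3 : ∀ k ∈ Finset.range (N + 1), (-1 : ℝ) ^ (k + 1) * ((N + 1).choose (k + 1) : ℝ) *
        rising b (k + 1) * rising (c + (k + 1 : ℕ)) (N + 1 - (k + 1)) =
        (-1) ^ (k + 1) * (N.choose k : ℝ) * rising b (k + 1) *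
          rising (c + (k + 1 : ℕ)) (N + 1 - (k + 1)) +
        (-1) ^ (k + 1) * (N.choose (k + 1) : ℝ) * rising b (k + 1) *
          rising (c + (k + 1 : ℕ)) (N + 1 - (k + 1)) := by
      intro k _
      rw [Nat.choose_succ_succ]; push_cast; ring
    have h4 := Finset.sum_range_succ (fun x => (-1 : ℝ) ^ (x + 1) * (N.choose (x + 1) : ℝ) *
      rising b (x + 1) * rising (c + (x + 1 : ℕ)) (N + 1 - (x + 1))) N
    have h5 := Finset.sum_range_succ' (fun x => (-1 : ℝ) ^ x * (N.choose x : ℝ) * rising b x *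
      rising (c + x) (N + 1 - x)) N
    rw [Finset.sum_congr rfl h3, Finset.sum_add_distrib, h4, h5]
    simp
    ring

theorem rising_one_sub (y : ℝ) (N : ℕ) : rising (1 - y - N) N = (-1) ^ N * rising y N := by
  rw [rising, rising, ← Finset.prod_range_reflect]
  have : (-1 : ℝ) ^ N = ∏ _i ∈ Finset.range N, (-1 : ℝ) := by simp
  rw [this, ← Finset.prod_mul_distrib]
  refine Finset.prod_congr rfl fun i hi => ?_
  have : i < N := Finset.mem_range.1 hi
  rw [Nat.sub_sub, Nat.cast_sub (by omega)]
  push_cast; ring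

/-- This is the coefficient of `z ^ N` in the double series of the quadratic transformation. Writing
`(l)_{N+k} = (l)_N (l + N)_k` makes it a Chu–Vandermonde sum with `b = l + N`, and `rising_one_sub`
reflects the resulting product. -/
theorem sum_antidiagonal_rising (l : ℝ) {c : ℝ} (hc : 0 < c) (N : ℕ) :
    ∑ p ∈ Finset.HasAntidiagonal.antidiagonal N, (-1 : ℝ) ^ p.2 * rising l (2 * p.1 + p.2) /
      (p.1.factorial * p.2.factorial * rising c p.1) =
      (N.factorial : ℝ)⁻¹ * rising l N * rising (l + 1 - c) N * (rising c N)⁻¹ := by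
  rw [Finset.Nat.sum_antidiagonal_eq_sum_range_succ_mk]
  have h := sum_choose_mul_rising N (l + N) c
  rw [show c - (l + N) = 1 - (l + 1 - c) - N by ring, rising_one_sub] at h
  have hs : ((-1 : ℝ) ^ N) * (-1) ^ N = 1 := by rw [← mul_pow]; simp
  have h' : rising (l + 1 - c) N = (-1) ^ N * ∑ k ∈ Finset.range (N + 1),
      (-1) ^ k * (N.choose k : ℝ) * rising (l + N) k * rising (c + k) (N - k) := by
    rw [h, ← mul_assoc, hs, one_mul]
  rw [h', Finset.mul_sum, Finset.mul_sum, Finset.sum_mul]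
  refine Finset.sum_congr rfl fun k hk => ?_
  have hk' : k ≤ N := Nat.lt_succ_iff.1 (Finset.mem_range.1 hk)
  have e1 : 2 * k + (N - k) = N + k := by omega
  have e2 : rising c N = rising c k * rising (c + k) (N - k) := by
    rw [← rising_add]; congr 1; omega
  have e3 : (N.choose k : ℝ) = N.factorial / (k.factorial * (N - k).factorial) :=
    Nat.cast_choose ℝ hk'
  have e4 : (-1 : ℝ) ^ N * (-1) ^ k = (-1) ^ (N - k) := by
    obtain ⟨m, rfl⟩ := Nat.exists_eq_add_of_le hk'
    rw [Nat.add_sub_cancel_left, pow_add]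
    have : ((-1 : ℝ) ^ k) * (-1) ^ k = 1 := by rw [← mul_pow]; simp
    linear_combination (-1 : ℝ) ^ m * this
  have p1 := rising_pos hc k
  have p2 := rising_pos (show 0 < c + k by positivity) (N - k)
  rw [e1, rising_add l N k, e2, e3, ← e4]
  field_simp

/-! ### Binomial and hypergeometric series -/

theorem hasSum_one_sub_rpow (a : ℝ) {x : ℝ} (hx : |x| < 1) :
    HasSum (fun k : ℕ => rising a k / k.factorial * x ^ k) ((1 - x) ^ (-a)) := by
  have h := (Real.one_div_one_sub_rpow_hasFPowerSeriesOnBall_zero a).hasSum (y := x)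
    (by simpa [enorm_eq_nnnorm, ← NNReal.coe_lt_one] using hx)
  have h1 : (0 : ℝ) ≤ 1 - x := by linarith [(abs_lt.1 hx).2]
  simp only [zero_add, one_div, ← Real.rpow_neg h1] at h
  convert! h using 2 with k
  rw [FormalMultilinearSeries.ofScalars_apply_eq, smul_eq_mul]
  congr 1
  rw [Ring.choose_eq_smul, Polynomial.descPochhammer_smeval_eq_ascPochhammer,
    Polynomial.ascPochhammer_smeval_eq_eval, ← ascPochhammer_eval_eq_rising, div_eq_inv_mul,
    show a + k - 1 - k + 1 = a by ring]
  simp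

theorem summable_rising (a : ℝ) {x : ℝ} (hx : |x| < 1) :
    Summable (fun k : ℕ => |rising a k / k.factorial * x ^ k|) := by
  refine Summable.of_nonneg_of_le (fun _ => abs_nonneg _) (fun k => ?_)
    (hasSum_one_sub_rpow |a| (x := |x|) (by simpa using hx)).summable
  rw [abs_mul, abs_div, abs_pow, Nat.abs_cast]
  gcongr
  exact abs_rising_le a k

theorem analyticOnNhd_tsum {d : ℕ → ℝ} {R : ℝ} (hR : 0 < R)
    (h : ∀ x : ℝ, |x| < R → Summable fun k => |d k * x ^ k|) :
    AnalyticOnNhd ℝ (fun x => ∑' k, d k * x ^ k) (ball 0 R) := by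
  set p := FormalMultilinearSeries.ofScalars ℝ d
  have hrad : ENNReal.ofReal R ≤ p.radius := by
    refine ENNReal.le_of_forall_nnreal_lt fun r hr => ?_
    have hr' : (r : ℝ) < R := by
      rw [ENNReal.lt_ofReal_iff_toReal_lt ENNReal.coe_ne_top] at hr
      simpa using hr
    apply p.le_radius_of_summable_norm
    refine (h r (by rwa [NNReal.abs_eq])).congr fun k => ?_
    rw [FormalMultilinearSeries.ofScalars_norm, abs_mul, abs_pow, NNReal.abs_eq,
      Real.norm_eq_abs]
  have hp := (p.hasFPowerSeriesOnBall (lt_of_lt_of_le (by simpa using hR) hrad)).mono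
    (by simpa using hR) hrad
  have hsum : p.sum = fun x => ∑' k, d k * x ^ k := by
    ext x
    simp [p, FormalMultilinearSeries.sum, mul_comm]
  rw [hsum] at hp
  have := hp.analyticOnNhd
  rwa [eball_ofReal] at this

theorem rising_mono {a b : ℝ} (ha : 0 ≤ a) (hab : a ≤ b) (k : ℕ) : rising a k ≤ rising b k :=
  Finset.prod_le_prod (fun _ _ => by positivity) fun i _ => by gcongr

theorem ordinaryHypergeometric_eq_tsum_rising (a b c : ℝ) : ordinaryHypergeometric a b c =
    fun x : ℝ => ∑' k, ((k.factorial : ℝ)⁻¹ * rising a k * rising b k * (rising c k)⁻¹) * x ^ k := by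
  rw [ordinaryHypergeometric_eq_tsum]
  simp [ascPochhammer_eval_eq_rising]

/-- The comparison series has parameters `|a| + 1` and `|b| + 1`: these are positive, so its radius
is exactly `1`, whereas the original series may terminate. -/
theorem summable_hypergeometric (a b : ℝ) {c : ℝ} (hc : 0 < c) {x : ℝ} (hx : |x| < 1) :
    Summable fun k : ℕ =>
      |((k.factorial : ℝ)⁻¹ * rising a k * rising b k * (rising c k)⁻¹) * x ^ k| := by
  have hrad := ordinaryHypergeometricSeries_radius_eq_one (𝕂 := ℝ) ℝ (|a| + 1) (|b| + 1) c
    (fun k => by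
      have h0 : (0 : ℝ) ≤ k := by positivity
      have h1 := abs_nonneg a
      have h2 := abs_nonneg b
      exact ⟨by linarith, by linarith, by linarith⟩)
  have hs := (ordinaryHypergeometricSeries ℝ (|a| + 1) (|b| + 1) c).summable_norm_mul_pow
    (r := ‖x‖₊) (by
      rw [hrad, ENNReal.coe_lt_one_iff, ← NNReal.coe_lt_one]; exact hx)
  refine Summable.of_nonneg_of_le (fun _ => abs_nonneg _) (fun k => ?_) hs
  rw [ordinaryHypergeometricSeries, FormalMultilinearSeries.ofScalars_norm,
    ordinaryHypergeometricCoefficient, ascPochhammer_eval_eq_rising, ascPochhammer_eval_eq_rising,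
    ascPochhammer_eval_eq_rising, Real.norm_eq_abs, abs_mul, abs_pow]
  have hm : ∀ a : ℝ, |rising a k| ≤ |rising (|a| + 1) k| := fun a =>
    (abs_rising_le a k).trans ((rising_mono (abs_nonneg a) (by linarith) k).trans (le_abs_self _))
  simp only [abs_mul]
  change _ ≤ _ * |x| ^ k
  gcongr _ * ?_ * ?_ * _ * _
  · exact hm a
  · exact hm b

theorem analyticOnNhd_ordinaryHypergeometric (a b : ℝ) {c : ℝ} (hc : 0 < c) :
    AnalyticOnNhd ℝ (ordinaryHypergeometric a b c : ℝ → ℝ) (ball 0 1) := by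
  rw [ordinaryHypergeometric_eq_tsum_rising]
  exact analyticOnNhd_tsum one_pos fun x hx => summable_hypergeometric a b hc hx

/-! ### The quadratic transformation and the means as hypergeometric functions -/

theorem integral_sphere_pow_even {n : ℕ} (hn : 0 < n) {v : 𝔼 n} (hv : ‖v‖ = 1) (k : ℕ) :
    ∫ ζ, (inner ℝ v (ζ : 𝔼 n)) ^ (2 * k) ∂(sphereMeasure n) =
      (2 * k).factorial / (4 ^ k * k.factorial * rising ((n : ℝ) / 2) k) := by
  have : NeZero n := ⟨by omega⟩
  have hn' : (0 : ℝ) < n := by exact_mod_cast hn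
  induction k with
  | zero => simp
  | succ k ih =>
    have h := integral_sphere_pow_add_two hn hv (2 * k)
    have h3 : ((2 * k : ℕ) : ℝ) + n ≠ 0 := by positivity
    apply mul_left_cancel₀ h3
    rw [show 2 * (k + 1) = 2 * k + 2 by ring, h, ih, Nat.factorial_succ, Nat.factorial_succ,
      Nat.factorial_succ, rising_succ]
    have := rising_pos (show 0 < (n : ℝ) / 2 by positivity) k
    push_cast
    field_simp
    ring

/-- The binomial series is integrated term by term; the odd moments vanish, and `(2k)!` cancels
against the even ones. -/
theorem hasSum_integral_one_sub_rpow {n : ℕ} (hn : 0 < n) {v : 𝔼 n} (hv : ‖v‖ = 1) (l : ℝ)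
    {ρ : ℝ} (hρ : |ρ| < 1) :
    HasSum (fun k : ℕ => rising l (2 * k) / (k.factorial * rising ((n : ℝ) / 2) k) *
      (ρ ^ 2 / 4) ^ k)
      (∫ ζ, (1 - ρ * inner ℝ v (ζ : 𝔼 n)) ^ (-l) ∂(sphereMeasure n)) := by
  have : NeZero n := ⟨by omega⟩
  have hn' : (0 : ℝ) < n := by exact_mod_cast hn
  set F : ℕ → sphere (0 : 𝔼 n) 1 → ℝ := fun k ζ =>
    rising l k / k.factorial * ρ ^ k * (inner ℝ v (ζ : 𝔼 n)) ^ k with hF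
  have hFi : ∀ k, Integrable (F k) (sphereMeasure n) := fun k =>
    integrable_comp_inner_sphere hv (f := fun s => rising l k / k.factorial * ρ ^ k * s ^ k)
      (by fun_prop)
  have hs1 : ∀ ζ : sphere (0 : 𝔼 n) 1, |inner ℝ v (ζ : 𝔼 n)| ≤ 1 := fun ζ =>
    abs_le.2 (inner_sphere_mem_Icc hv ζ)
  have hFs : Summable fun k => ∫ ζ, ‖F k ζ‖ ∂(sphereMeasure n) := by
    refine Summable.of_nonneg_of_le (fun k => integral_nonneg fun _ => norm_nonneg _) (fun k => ?_)
      (summable_rising l hρ)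
    have h1 : ∀ ζ, ‖F k ζ‖ ≤ |rising l k / k.factorial * ρ ^ k| := fun ζ => by
      rw [hF, Real.norm_eq_abs, abs_mul, abs_pow (inner ℝ v (ζ : 𝔼 n))]
      exact mul_le_of_le_one_right (abs_nonneg _) (pow_le_one₀ (abs_nonneg _) (hs1 ζ))
    calc ∫ ζ, ‖F k ζ‖ ∂(sphereMeasure n)
        ≤ ∫ ζ, |rising l k / k.factorial * ρ ^ k| ∂(sphereMeasure n) :=
          integral_mono (hFi k).norm (integrable_const _) h1
      _ = _ := by simp
  have h := hasSum_integral_of_summable_integral_norm hFi hFs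
  have h2 : ∀ ζ : sphere (0 : 𝔼 n) 1, ∑' k, F k ζ = (1 - ρ * inner ℝ v (ζ : 𝔼 n)) ^ (-l) := by
    intro ζ
    have hlt : |ρ * inner ℝ v (ζ : 𝔼 n)| < 1 := by
      rw [abs_mul]
      exact (mul_le_of_le_one_right (abs_nonneg _) (hs1 ζ)).trans_lt hρ
    rw [← (hasSum_one_sub_rpow l hlt).tsum_eq]
    congr 1; ext k; simp only [hF, mul_pow]; ring
  simp only [h2] at h
  have hinj : Function.Injective fun k : ℕ => 2 * k := fun a b hab => by simpa using hab
  rw [← hinj.hasSum_iff] at h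
  · convert! h using 2 with k
    simp only [Function.comp_apply, hF]
    rw [integral_const_mul, integral_sphere_pow_even hn hv]
    have := rising_pos (show 0 < (n : ℝ) / 2 by positivity) k
    rw [div_pow, ← pow_mul]
    field_simp
  · intro k hk
    have hodd : Odd k := by
      rw [← Nat.not_even_iff_odd]
      rintro ⟨m, hm⟩
      exact hk ⟨m, by simp only; omega⟩
    simp only [hF]
    rw [integral_const_mul, integral_sphere_pow_odd hn hv hodd, mul_zero]

theorem exists_norm_eq_one {n : ℕ} (hn : 0 < n) : ∃ v : 𝔼 n, ‖v‖ = 1 :=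
  ⟨EuclideanSpace.single ⟨0, hn⟩ 1, by simp⟩

/-- With `|l|` in place of `l` the terms are nonnegative and sum to the integral above at `ρ =
√(4|x|) < 1`; this majorizes the series. -/
theorem summable_quadratic {n : ℕ} (hn : 0 < n) (l : ℝ) {x : ℝ} (hx : |x| < 1 / 4) :
    Summable fun k : ℕ => |rising l (2 * k) / (k.factorial * rising ((n : ℝ) / 2) k) * x ^ k| := by
  have hn' : (0 : ℝ) < n := by exact_mod_cast hn
  obtain ⟨v, hv⟩ := exists_norm_eq_one hn
  have hsq : Real.sqrt (4 * |x|) ^ 2 = 4 * |x| := Real.sq_sqrt (by positivity)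
  have h := (hasSum_integral_one_sub_rpow hn hv |l| (ρ := Real.sqrt (4 * |x|)) (by
    rw [abs_of_nonneg (Real.sqrt_nonneg _), Real.sqrt_lt' one_pos]; linarith)).summable
  refine Summable.of_nonneg_of_le (fun _ => abs_nonneg _) (fun k => ?_) h
  have hp := rising_pos (show 0 < (n : ℝ) / 2 by positivity) k
  rw [hsq, abs_mul, abs_div, abs_pow, abs_of_pos (show (0 : ℝ) < k.factorial *
    rising ((n : ℝ) / 2) k by positivity), mul_div_cancel_left₀ _ (by norm_num : (4 : ℝ) ≠ 0)]
  gcongr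
  exact abs_rising_le _ _

/-- Each `(1 + z) ^ (-(l + 2k))` is expanded in powers of `z`, and the resulting absolutely
convergent double series is summed along antidiagonals. -/
theorem hasSum_hypergeometric_of_small {n : ℕ} (hn : 0 < n) (l : ℝ) {z : ℝ} (hz : |z| ≤ 1 / 10) :
    (1 + z) ^ (-l) * ∑' k : ℕ, rising l (2 * k) / (k.factorial * rising ((n : ℝ) / 2) k) *
      (z / (1 + z) ^ 2) ^ k = ordinaryHypergeometric l (l + 1 - (n : ℝ) / 2) ((n : ℝ) / 2) z := by
  have hn' : (0 : ℝ) < (n : ℝ) / 2 := by have : (0 : ℝ) < n := by exact_mod_cast hn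
                                         positivity
  set c := (n : ℝ) / 2 with hc
  set T : ℕ × ℕ → ℝ := fun p => (-1 : ℝ) ^ p.2 * rising l (2 * p.1 + p.2) /
      (p.1.factorial * p.2.factorial * rising c p.1) * z ^ (p.1 + p.2) with hT
  have hrow : ∀ (l y : ℝ) (k : ℕ), |y| < 1 → HasSum (fun j : ℕ =>
      rising l (2 * k + j) / (k.factorial * j.factorial * rising c k) * y ^ j)
      (rising l (2 * k) / (k.factorial * rising c k) * (1 - y) ^ (-(l + 2 * k))) := by
    intro l y k hy
    refine ((hasSum_one_sub_rpow (l + 2 * k) hy).mul_left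
      (rising l (2 * k) / (k.factorial * rising c k))).congr_fun ?_
    intro j
    have := rising_pos hn' k
    rw [rising_add]
    push_cast
    field_simp
  have hpw : ∀ (l y : ℝ) (k : ℕ), 0 < 1 - y → (1 - y) ^ (-(l + 2 * k)) * y ^ k =
      (1 - y) ^ (-l) * (y / (1 - y) ^ 2) ^ k := by
    intro l y k hy
    rw [neg_add, Real.rpow_add hy, div_pow, ← pow_mul, Real.rpow_neg hy.le (2 * k)]
    rw [show (2 * (k : ℝ)) = ((2 * k : ℕ) : ℝ) by push_cast; ring, Real.rpow_natCast]
    field_simp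
  have hz1 : |z| < 1 := by linarith
  have hz2 := abs_le.1 hz
  have hTabs : Summable fun p => |T p| := by
    set T' : ℕ × ℕ → ℝ := fun p => rising |l| (2 * p.1 + p.2) /
      (p.1.factorial * p.2.factorial * rising c p.1) * |z| ^ (p.1 + p.2) with hT'
    have hT'0 : ∀ p, 0 ≤ T' p := fun p => by
      have := rising_nonneg (abs_nonneg l) (2 * p.1 + p.2)
      have := rising_pos hn' p.1
      positivity
    have hr' : ∀ k, HasSum (fun j => T' (k, j)) (rising |l| (2 * k) / (k.factorial * rising c k) *
        ((1 - |z|) ^ (-|l|) * (|z| / (1 - |z|) ^ 2) ^ k)) := by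
      intro k
      have := (hrow |l| |z| k (by simpa using hz1)).mul_right (|z| ^ k)
      rw [mul_assoc, hpw _ _ _ (by linarith)] at this
      refine this.congr_fun fun j => ?_
      simp only [hT', pow_add]; ring
    have hsT' : Summable T' := by
      rw [summable_prod_of_nonneg hT'0]
      refine ⟨fun k => (hr' k).summable, ?_⟩
      simp_rw [fun k => (hr' k).tsum_eq]
      -- The reason for the bound `1 / 10`: the majorant is the series at `-|z|`, and its argument
      -- must stay below `1 / 4`.
      have hlt : |(|z| / (1 - |z|) ^ 2)| < 1 / 4 := by
        rw [abs_of_nonneg (by positivity), div_lt_iff₀ (by nlinarith)]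
        nlinarith
      have := (summable_quadratic hn |l| hlt).of_abs.mul_left ((1 - |z|) ^ (-|l|))
      refine this.congr fun k => ?_
      ring
    refine Summable.of_nonneg_of_le (fun _ => abs_nonneg _) (fun p => ?_) hsT'
    have := rising_pos hn' p.1
    rw [hT, abs_mul, abs_div, abs_mul, abs_pow, abs_pow, abs_neg, abs_one, one_pow, one_mul,
      abs_of_pos (show (0 : ℝ) < p.1.factorial * p.2.factorial * rising c p.1 by positivity)]
    simp only [hT']
    gcongr
    exact abs_rising_le _ _
  have hTs : Summable T := hTabs.of_abs
  have hleft : ∑' p, T p = (1 + z) ^ (-l) * ∑' k : ℕ, rising l (2 * k) /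
      (k.factorial * rising c k) * (z / (1 + z) ^ 2) ^ k := by
    rw [hTs.tsum_prod, ← tsum_mul_left]
    congr 1; ext k
    have h1 := (hrow l (-z) k (by simpa using hz1)).mul_right (z ^ k)
    have h2 := hpw l (-z) k (by linarith)
    have h3 : (-z) ^ k = (-1) ^ k * z ^ k := by rw [← mul_pow]; simp
    have h4 : (-z / (1 + z) ^ 2) ^ k = (-1) ^ k * (z / (1 + z) ^ 2) ^ k := by
      rw [← mul_pow]; congr 1; ring
    rw [sub_neg_eq_add, h3, h4] at h2
    have h5 : (1 + z) ^ (-(l + 2 * k)) * z ^ k = (1 + z) ^ (-l) * (z / (1 + z) ^ 2) ^ k := by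
      have : ((-1 : ℝ) ^ k) ≠ 0 := by positivity
      apply mul_left_cancel₀ this
      linear_combination h2
    rw [sub_neg_eq_add, mul_assoc, h5] at h1
    rw [mul_left_comm, ← h1.tsum_eq]
    congr 1; ext j
    have h6 : (-z) ^ j = (-1) ^ j * z ^ j := by rw [← mul_pow]; simp
    simp only [hT, h6, pow_add]; ring
  rw [← hleft, ordinaryHypergeometric_eq_tsum_rising,
    ← Finset.HasAntidiagonal.sigmaAntidiagonalEquivProd.tsum_eq]
  have hs := (Finset.HasAntidiagonal.sigmaAntidiagonalEquivProd (A := ℕ)).summable_iff.2 hTs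
  have hs' := hs.tsum_sigma
  simp only [Function.comp_apply] at hs'
  rw [hs']
  congr 1; ext N
  rw [tsum_fintype, ← sum_antidiagonal_rising l hn', Finset.sum_mul,
    ← Finset.sum_coe_sort (Finset.HasAntidiagonal.antidiagonal N)]
  refine Finset.sum_congr rfl fun p _ => ?_
  have hp := Finset.HasAntidiagonal.mem_antidiagonal.1 p.2
  simp only [Finset.HasAntidiagonal.sigmaAntidiagonalEquivProd_apply, hT]
  rw [hp]

/-- Analytic continuation from a neighbourhood of `0`: on `(-1/10, 1)` both sides are analytic,
because `|z / (1 + z) ^ 2| < 1 / 4` there, which for positive `z` is `(1 - z) ^ 2 > 0`. -/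
theorem ordinaryHypergeometric_quadratic {n : ℕ} (hn : 0 < n) (l : ℝ) {z : ℝ} (hz0 : 0 ≤ z)
    (hz1 : z < 1) :
    (1 + z) ^ (-l) * ∑' k : ℕ, rising l (2 * k) / (k.factorial * rising ((n : ℝ) / 2) k) *
      (z / (1 + z) ^ 2) ^ k = ordinaryHypergeometric l (l + 1 - (n : ℝ) / 2) ((n : ℝ) / 2) z := by
  have hn' : (0 : ℝ) < (n : ℝ) / 2 := by have : (0 : ℝ) < n := by exact_mod_cast hn
                                         positivity
  set U := Ioo (-(1 / 10) : ℝ) 1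
  have hD := analyticOnNhd_tsum (by norm_num) fun x hx => summable_quadratic hn l (x := x) hx
  have hf : AnalyticOnNhd ℝ (fun z : ℝ => (1 + z) ^ (-l) * ∑' k : ℕ, rising l (2 * k) /
      (k.factorial * rising ((n : ℝ) / 2) k) * (z / (1 + z) ^ 2) ^ k) U := by
    intro x hx
    have hx1 : 0 < 1 + x := by linarith [hx.1]
    have hq : AnalyticAt ℝ (fun z : ℝ => z / (1 + z) ^ 2) x :=
      analyticAt_id.div ((analyticAt_const.add analyticAt_id).pow 2) (by positivity)
    refine AnalyticAt.mul ?_ ?_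
    · refine Real.one_add_rpow_hasFPowerSeriesOnBall_zero.analyticOnNhd x ?_
      rw [← ENNReal.ofReal_one, eball_ofReal, mem_ball_zero_iff, Real.norm_eq_abs, abs_lt]
      exact ⟨by linarith, hx.2⟩
    · refine AnalyticAt.fun_comp (hD _ ?_) hq
      rw [mem_ball_zero_iff, Real.norm_eq_abs, abs_lt, lt_div_iff₀ (by positivity),
        div_lt_iff₀ (by positivity)]
      have := hx.1
      have := hx.2
      constructor <;> nlinarith [sq_pos_of_pos (sub_pos.2 hx.2)]
  have hg : AnalyticOnNhd ℝ (ordinaryHypergeometric l (l + 1 - (n : ℝ) / 2) ((n : ℝ) / 2) : ℝ → ℝ)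
      U := fun x hx => analyticOnNhd_ordinaryHypergeometric _ _ hn' x (by
    rw [mem_ball_zero_iff, Real.norm_eq_abs, abs_lt]
    exact ⟨by linarith [hx.1], hx.2⟩)
  have heq := hf.eqOn_of_preconnected_of_eventuallyEq hg isPreconnected_Ioo
    (show (0 : ℝ) ∈ U by constructor <;> norm_num) (by
      filter_upwards [Metric.closedBall_mem_nhds (0 : ℝ) (by norm_num : (0 : ℝ) < 1 / 10)] with z hz
      rw [mem_closedBall_zero_iff, Real.norm_eq_abs] at hz
      exact hasSum_hypergeometric_of_small hn l hz)
  exact heq ⟨by linarith, hz1⟩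

/-- Factor `1 + r² - 2rs = (1 + r²)(1 - ρs)` with `ρ = 2r / (1 + r²)`; then `ρ² / 4 = z / (1 + z)²`
for `z = r²`, the argument of the quadratic transformation. -/
theorem sphereMean_eq_ordinaryHypergeometric {n : ℕ} (hn : 3 ≤ n) (l : ℝ) {r : ℝ} (hr0 : 0 ≤ r)
    (hr1 : r < 1) : sphereMean n (-l) r =
      ordinaryHypergeometric l (l + 1 - (n : ℝ) / 2) ((n : ℝ) / 2) (r ^ 2) := by
  obtain ⟨v, hv⟩ := exists_norm_eq_one (n := n) (by omega)
  rw [← ordinaryHypergeometric_quadratic (by omega) l (sq_nonneg r) (by nlinarith),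
    ← integral_sphere_eq_sphereMean hn hv hr0 hr1]
  have hρ : |2 * r / (1 + r ^ 2)| < 1 := by
    rw [abs_of_nonneg (by positivity), div_lt_one (by positivity)]
    nlinarith [sq_pos_of_pos (sub_pos.2 hr1)]
  have h := hasSum_integral_one_sub_rpow (n := n) (by omega) hv l hρ
  have e : (2 * r / (1 + r ^ 2)) ^ 2 / 4 = r ^ 2 / (1 + r ^ 2) ^ 2 := by field_simp; ring
  rw [e] at h
  rw [h.tsum_eq, ← integral_const_mul]
  congr 1; ext ζ
  have hs := inner_sphere_mem_Icc hv ζ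
  have h1 := one_add_sq_sub_pos hr0 hr1 hs
  have e2 : 1 + r ^ 2 - 2 * r * inner ℝ v (ζ : 𝔼 n) =
      (1 + r ^ 2) * (1 - 2 * r / (1 + r ^ 2) * inner ℝ v (ζ : 𝔼 n)) := by field_simp
  rw [e2] at h1 ⊢
  rw [Real.mul_rpow (by positivity) (pos_of_mul_pos_right h1 (by positivity)).le]

theorem sphereMean_eq_hyperF₁ {n : ℕ} (hn : 3 ≤ n) (α : ℝ) {r : ℝ} (hr0 : 0 ≤ r) (hr1 : r < 1) :
    sphereMean n (1 - (n + α) / 2) r = hyperF₁ n α r := by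
  have h := sphereMean_eq_ordinaryHypergeometric hn (((n : ℝ) + α) / 2 - 1) hr0 hr1
  rw [neg_sub] at h
  rw [h, hyperF₁, ordinaryHypergeometric, ordinaryHypergeometricSeries_symm,
    show ((n : ℝ) + α) / 2 - 1 + 1 - n / 2 = α / 2 by ring]
  rfl

theorem sphereMean_eq_hyperF₂ {n : ℕ} (hn : 3 ≤ n) (α : ℝ) {r : ℝ} (hr0 : 0 ≤ r) (hr1 : r < 1) :
    sphereMean n (2 - (n + α) / 2) r = hyperF₂ n α r := by
  have h := sphereMean_eq_ordinaryHypergeometric hn (((n : ℝ) + α) / 2 - 2) hr0 hr1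
  rw [neg_sub] at h
  rw [h, hyperF₂, ordinaryHypergeometric, ordinaryHypergeometricSeries_symm,
    show ((n : ℝ) + α) / 2 - 2 + 1 - n / 2 = α / 2 - 1 by ring]
  rfl

/-- Inversion replaces the exponent of the kernel by the one whose mean is `F₁` and extracts the
power of `1 - r ^ 2`. The next lemma does the same with `F₂` for the exponent in the gradient. -/
theorem sphereMean_kernel {n : ℕ} (hn : 3 ≤ n) (α : ℝ) {r : ℝ} (hr0 : 0 ≤ r) (hr1 : r < 1) :
    sphereMean n (-((n - α) / 2)) r = (1 - r ^ 2) ^ (α - 1) * hyperF₁ n α r := by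
  rw [sphereMean_eq_inversion hn hr0 hr1, ← sphereMean_eq_hyperF₁ hn α hr0 hr1]
  congr 2 <;> ring

theorem sphereMean_kernel_deriv {n : ℕ} (hn : 3 ≤ n) (α : ℝ) {r : ℝ} (hr0 : 0 ≤ r) (hr1 : r < 1) :
    sphereMean n (-((n + 2 - α) / 2)) r = (1 - r ^ 2) ^ (α - 3) * hyperF₂ n α r := by
  rw [sphereMean_eq_inversion hn hr0 hr1, ← sphereMean_eq_hyperF₂ hn α hr0 hr1]
  congr 2 <;> ring

/-! ### The integral inequality that produces `g` -/

/-- What remains of the uniform case after explicit integration, with `m = q - 1`. In terms of `a =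
(1 - r) ^ (2m)` and `b = (1 + r) ^ (-2m)`, three uses of Bernoulli's inequality suffice. -/
theorem two_mul_sq_add_le {m r : ℝ} (hm : 1 < m) (hr0 : 0 < r) (hr1 : r < 1) :
    2 * m * r ^ 2 + 2 * (((1 - r) ^ 2) ^ (-m) - 1) ≤
      (2 * (1 + r ^ 2) ^ (m + 1) - (1 - r) ^ (2 * (m + 1))) *
        (((1 - r) ^ 2) ^ (-m) - ((1 + r) ^ 2) ^ (-m)) := by
  have h1r : 0 < 1 - r := by linarith
  set a := (1 - r) ^ (2 * m) with ha
  set b := (1 + r) ^ (-(2 * m)) with hb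
  have ha0 : 0 < a := Real.rpow_pos_of_pos h1r _
  have hb0 : 0 < b := Real.rpow_pos_of_pos (by linarith) _
  have eX : ((1 - r) ^ 2) ^ (-m) = 1 / a := by
    rw [← Real.rpow_natCast, ← Real.rpow_mul h1r.le, ha, one_div, ← Real.rpow_neg h1r.le]
    congr 1; push_cast; ring
  have eY : ((1 + r) ^ 2) ^ (-m) = b := by
    rw [← Real.rpow_natCast, ← Real.rpow_mul (by linarith), hb]
    congr 1; push_cast; ring
  have eA : (1 - r) ^ (2 * (m + 1)) = a * (1 - r) ^ 2 := by
    rw [ha, ← Real.rpow_natCast, ← Real.rpow_add h1r]; congr 1; push_cast; ring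
  have hB : 1 + (m + 1) * r ^ 2 ≤ (1 + r ^ 2) ^ (m + 1) :=
    one_add_mul_self_le_rpow_one_add (by nlinarith) (by linarith)
  have hbt : b * (2 * m * r) ≤ 1 - b := by
    have h := one_add_mul_self_le_rpow_one_add (s := r) (p := 2 * m) (by linarith) (by linarith)
    have e : b * (1 + r) ^ (2 * m) = 1 := by
      rw [hb, ← Real.rpow_add (by linarith)]; simp
    have := mul_le_mul_of_nonneg_left h hb0.le
    rw [e] at this
    linarith
  have hab : b * (1 - 2 * m * r ^ 2) ≤ a := by
    have h := one_add_mul_self_le_rpow_one_add (s := -r ^ 2) (p := 2 * m) (by nlinarith)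
      (by linarith)
    have e : a = b * (1 + -r ^ 2) ^ (2 * m) := by
      rw [show 1 + -r ^ 2 = (1 - r) * (1 + r) by ring, Real.mul_rpow h1r.le (by linarith), ha, hb,
        mul_left_comm, ← Real.rpow_add (by linarith)]
      simp
    rw [e]
    exact mul_le_mul_of_nonneg_left (by linarith) hb0.le
  have hale : a ≤ b := by
    rw [ha, hb, Real.rpow_neg (by linarith), ← Real.inv_rpow (by linarith)]
    apply Real.rpow_le_rpow h1r.le _ (by linarith)
    rw [le_inv_comm₀ h1r (by linarith), ← one_div, le_div_iff₀ h1r]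
    nlinarith
  have hb1 : b ≤ 1 := by linarith [mul_pos hb0 (mul_pos (by linarith : 0 < 2 * m) hr0)]
  rw [eX, eY, eA]
  have hX : 1 / b ≤ 1 / a := one_div_le_one_div_of_le ha0 hale
  have hc : 1 ≤ 1 / b := by rw [le_div_iff₀ hb0]; linarith
  have e1 : (2 * (1 + r ^ 2) ^ (m + 1) - a * (1 - r) ^ 2) * (1 / a - b) =
      2 * (1 + r ^ 2) ^ (m + 1) * (1 / a - b) - (1 - r) ^ 2 * (1 - a * b) := by
    field_simp
  rw [e1]
  -- The terms `2 / a` cancel. In the others `1 / a` is lowered to `1 / b`, and `a` to its Bernoulli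
  -- bound, so that only `b` and `r` remain; the surplus is at least `(1 - b) ^ 2` plus nonnegative
  -- terms.
  have i1 : 2 * (1 + (m + 1) * r ^ 2) * (1 / a - b) ≤ 2 * (1 + r ^ 2) ^ (m + 1) * (1 / a - b) :=
    mul_le_mul_of_nonneg_right (by linarith) (by linarith)
  have i2 : 2 * (m + 1) * r ^ 2 * (1 / b - b) ≤ 2 * (m + 1) * r ^ 2 * (1 / a - b) :=
    mul_le_mul_of_nonneg_left (by linarith) (by positivity)
  have i3 : (1 - r) ^ 2 * (1 - a * b) ≤ (1 - r) ^ 2 * (1 - b ^ 2 + 2 * m * r ^ 2 * b ^ 2) :=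
    mul_le_mul_of_nonneg_left (by linarith [mul_le_mul_of_nonneg_left hab hb0.le]) (sq_nonneg _)
  have i4 : (1 - r) ^ 2 * (2 * m * r ^ 2 * b ^ 2) ≤ r * b * (1 - b) := by
    have h1 : (1 - r) ^ 2 * (2 * m * r ^ 2 * b ^ 2) ≤ 1 * (2 * m * r ^ 2 * b ^ 2) :=
      mul_le_mul_of_nonneg_right (by nlinarith) (by positivity)
    have h2 := mul_le_mul_of_nonneg_left hbt (show 0 ≤ r * b by positivity)
    linarith
  have i5 : 2 * m * r ^ 2 * (1 - 1 / b + b) ≤ r * (1 - b) := by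
    have h1 : 2 * m * r ^ 2 * (1 - 1 / b + b) ≤ 2 * m * r ^ 2 * b :=
      mul_le_mul_of_nonneg_left (by linarith) (by positivity)
    have h2 := mul_le_mul_of_nonneg_left hbt hr0.le
    linarith
  have i6 : 0 ≤ 2 * r ^ 2 * (1 / b - b) := mul_nonneg (by positivity) (by linarith)
  have i7 : 0 ≤ (r - r ^ 2) * (1 - b ^ 2) := mul_nonneg
    (by linarith [mul_le_mul_of_nonneg_left hr1.le hr0.le])
    (by linarith [mul_le_mul_of_nonneg_left hb1 hb0.le])
  linarith [sq_nonneg (1 - b)]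

/-- Integrating a function that changes sign once, from negative to positive, against a
decreasing weight. -/
theorem integral_mul_nonpos_of_single_crossing {F w : ℝ → ℝ} (hF : ContinuousOn F (Icc 0 1))
    (hw : ContinuousOn w (Icc 0 1)) (hwa : AntitoneOn w (Icc 0 1)) (hw0 : ∀ s ∈ Icc (0 : ℝ) 1, 0 ≤ w s)
    (hcross : ∀ s ∈ Icc (0 : ℝ) 1, ∀ t ∈ Icc (0 : ℝ) 1, s < t → 0 < F s → 0 ≤ F t)
    (hint : ∫ s in (0 : ℝ)..1, F s ≤ 0) : ∫ s in (0 : ℝ)..1, F s * w s ≤ 0 := by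
  -- The point `1` is added so that the crossing point `s₀` exists even if `F` is never positive.
  set S : Set ℝ := {s | s ∈ Icc (0 : ℝ) 1 ∧ (0 < F s ∨ s = 1)}
  have hS1 : (1 : ℝ) ∈ S := ⟨by simp, Or.inr rfl⟩
  have hSb : BddBelow S := ⟨0, fun s hs => hs.1.1⟩
  set s₀ := sInf S
  have hs₀ : s₀ ∈ Icc (0 : ℝ) 1 := ⟨le_csInf ⟨1, hS1⟩ fun s hs => hs.1.1, csInf_le hSb hS1⟩
  have hpt : ∀ s ∈ Icc (0 : ℝ) 1, F s * w s ≤ F s * w s₀ := by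
    intro s hs
    rcases lt_trichotomy s s₀ with h | h | h
    · have hFs : F s ≤ 0 := by
        by_contra hcon
        exact absurd (csInf_le hSb (show s ∈ S from ⟨hs, Or.inl (not_le.1 hcon)⟩)) (not_le.2 h)
      exact mul_le_mul_of_nonpos_left (hwa hs hs₀ h.le) hFs
    · rw [h]
    · obtain ⟨s', hs', hlt⟩ := exists_lt_of_csInf_lt ⟨1, hS1⟩ h
      have hFs' : 0 < F s' := hs'.2.resolve_right fun h1 => by linarith [hs.2]
      exact mul_le_mul_of_nonneg_left (hwa hs₀ hs h.le) (hcross s' hs'.1 s hs hlt hFs')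
  have hu : uIcc (0 : ℝ) 1 = Icc 0 1 := uIcc_of_le zero_le_one
  calc ∫ s in (0 : ℝ)..1, F s * w s ≤ ∫ s in (0 : ℝ)..1, F s * w s₀ :=
        intervalIntegral.integral_mono_on zero_le_one
          ((hF.mul hw).intervalIntegrable_of_Icc zero_le_one)
          ((hF.mul continuousOn_const).intervalIntegrable_of_Icc zero_le_one) hpt
    _ = (∫ s in (0 : ℝ)..1, F s) * w s₀ := intervalIntegral.integral_mul_const _ _
    _ ≤ 0 := mul_nonpos_of_nonpos_of_nonneg hint (hw0 _ hs₀)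

theorem weight_antitoneOn {n : ℕ} (hn : 3 ≤ n) : AntitoneOn (weight n) (Icc 0 1) := by
  intro s hs t ht hst
  have hn' : (3 : ℝ) ≤ n := by exact_mod_cast hn
  exact Real.rpow_le_rpow (by nlinarith [ht.1, ht.2]) (by nlinarith [hs.1]) (by linarith)

theorem integral_symm_interval {f : ℝ → ℝ} (hf : ContinuousOn f (Icc (-1) 1)) :
    ∫ s in (-1 : ℝ)..1, f s = ∫ s in (0 : ℝ)..1, (f s + f (-s)) := by
  have h1 : IntervalIntegrable f volume (-1) 0 :=
    (hf.mono (Icc_subset_Icc le_rfl zero_le_one)).intervalIntegrable_of_Icc (by norm_num)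
  have h2 : IntervalIntegrable f volume 0 1 :=
    (hf.mono (Icc_subset_Icc (by norm_num) le_rfl)).intervalIntegrable_of_Icc (by norm_num)
  have h3 : IntervalIntegrable (fun s => f (-s)) volume 0 1 := by
    refine ContinuousOn.intervalIntegrable_of_Icc zero_le_one (hf.comp (by fun_prop) ?_)
    intro s hs
    exact ⟨by linarith [hs.2], by linarith [hs.1]⟩
  rw [intervalIntegral.integral_add h2 h3, intervalIntegral.integral_comp_neg,
    ← intervalIntegral.integral_add_adjacent_intervals h1 h2]
  simp only [neg_zero]
  ring

theorem integral_rpow_one_add_sq_sub {m r : ℝ} (hm : 0 < m) (hr0 : 0 < r) (hr1 : r < 1)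
    {a b : ℝ} (ha : a ∈ Icc (-1 : ℝ) 1) (hb : b ∈ Icc (-1 : ℝ) 1) :
    ∫ s in a..b, (1 + r ^ 2 - 2 * r * s) ^ (-(m + 1)) =
      ((1 + r ^ 2 - 2 * r * b) ^ (-m) - (1 + r ^ 2 - 2 * r * a) ^ (-m)) / (2 * r * m) := by
  have hsub : uIcc a b ⊆ Icc (-1 : ℝ) 1 := uIcc_subset_Icc ha hb
  have hd : ∀ s ∈ uIcc a b, HasDerivAt (fun s : ℝ => (1 + r ^ 2 - 2 * r * s) ^ (-m) / (2 * r * m))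
      ((1 + r ^ 2 - 2 * r * s) ^ (-(m + 1))) s := by
    intro s hs
    have hp := one_add_sq_sub_pos hr0.le hr1 (hsub hs)
    have h2 : HasDerivAt (fun t : ℝ => 1 + r ^ 2 - 2 * r * t) (-(2 * r * 1)) s :=
      ((hasDerivAt_id s).const_mul (2 * r)).const_sub _
    refine ((h2.rpow_const (p := -m) (Or.inl hp.ne')).div_const (2 * r * m)).congr_deriv ?_
    rw [show -m - 1 = -(m + 1) by ring]
    field_simp
  rw [intervalIntegral.integral_eq_sub_of_hasDerivAt hd
    (((continuousOn_one_add_sq_sub_rpow hr0.le hr1 _).mono hsub).intervalIntegrable), sub_div]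

/-- The basic integral inequality against the uniform density. -/
theorem integral_abs_sub_one_uniform {q r : ℝ} (hq : 2 < q) (hr0 : 0 < r) (hr1 : r < 1) :
    ∫ s in (-1 : ℝ)..1, (|(1 + r ^ 2 - 2 * r * s) ^ (-q) - 1| + (1 + r ^ 2 - 2 * r * s) ^ (-q) -
      (2 * (1 + r ^ 2) ^ q - (1 - r) ^ (2 * q)) * (1 + r ^ 2 - 2 * r * s) ^ (-q)) ≤ 0 := by
  obtain ⟨m, rfl⟩ : ∃ m, q = m + 1 := ⟨q - 1, by ring⟩
  set L := 2 * (1 + r ^ 2) ^ (m + 1) - (1 - r) ^ (2 * (m + 1))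
  set V : ℝ → ℝ := fun s => (1 + r ^ 2 - 2 * r * s) ^ (-(m + 1)) with hV
  have hm : 1 < m := by linarith
  have hVc : ContinuousOn V (Icc (-1) 1) := continuousOn_one_add_sq_sub_rpow hr0.le hr1 _
  have hr2 : r / 2 ∈ Icc (-1 : ℝ) 1 := ⟨by linarith, by linarith⟩
  have hm1 : (-1 : ℝ) ∈ Icc (-1 : ℝ) 1 := by simp
  have hp1 : (1 : ℝ) ∈ Icc (-1 : ℝ) 1 := by simp
  have hfc : ContinuousOn (fun s => |V s - 1| + V s - L * V s) (Icc (-1) 1) := by fun_prop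
  have hi : ∀ {f : ℝ → ℝ}, ContinuousOn f (Icc (-1) 1) → ∀ {a b : ℝ}, a ∈ Icc (-1 : ℝ) 1 →
      b ∈ Icc (-1 : ℝ) 1 → IntervalIntegrable f volume a b := fun hf _ _ ha hb =>
    (hf.mono (uIcc_subset_Icc ha hb)).intervalIntegrable
  -- `V = 1` exactly at `s = r / 2`, where `1 + r² - 2rs = 1`; this removes the absolute value.
  have hI1 : ∫ s in (-1 : ℝ)..(r / 2), (|V s - 1| + V s - L * V s) =
      ∫ s in (-1 : ℝ)..(r / 2), (1 - L * V s) := by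
    refine intervalIntegral.integral_congr fun s hs => ?_
    rw [uIcc_of_le hr2.1] at hs
    have : V s ≤ 1 := Real.rpow_le_one_of_one_le_of_nonpos (by nlinarith [hs.2]) (by linarith)
    rw [abs_of_nonpos (by linarith)]; ring
  have hI2 : ∫ s in (r / 2)..1, (|V s - 1| + V s - L * V s) =
      ∫ s in (r / 2)..1, ((2 - L) * V s - 1) := by
    refine intervalIntegral.integral_congr fun s hs => ?_
    rw [uIcc_of_le hr2.2] at hs
    have hp := one_add_sq_sub_pos hr0.le hr1 ⟨by linarith [hs.1], hs.2⟩
    have : 1 ≤ V s := Real.one_le_rpow_of_pos_of_le_one_of_nonpos hp (by nlinarith [hs.1])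
      (by linarith)
    rw [abs_of_nonneg (by linarith)]; ring
  rw [← intervalIntegral.integral_add_adjacent_intervals (hi hfc hm1 hr2) (hi hfc hr2 hp1), hI1, hI2,
    intervalIntegral.integral_sub (by simp) ((hi hVc hm1 hr2).const_mul _),
    intervalIntegral.integral_sub ((hi hVc hr2 hp1).const_mul _) (by simp),
    intervalIntegral.integral_const_mul, intervalIntegral.integral_const_mul, hV,
    integral_rpow_one_add_sq_sub (by linarith) hr0 hr1 hm1 hr2,
    integral_rpow_one_add_sq_sub (by linarith) hr0 hr1 hr2 hp1]
  have h := two_mul_sq_add_le hm hr0 hr1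
  have e1 : 1 + r ^ 2 - 2 * r * 1 = (1 - r) ^ 2 := by ring
  have e2 : 1 + r ^ 2 - 2 * r * (-1) = (1 + r) ^ 2 := by ring
  have e3 : 1 + r ^ 2 - 2 * r * (r / 2) = 1 := by ring
  rw [e1, e2, e3, Real.one_rpow]
  simp only [intervalIntegral.integral_const, smul_eq_mul, mul_one]
  change 2 * m * r ^ 2 + 2 * (((1 - r) ^ 2) ^ (-m) - 1) ≤ L * _ at h
  set X := ((1 - r) ^ 2) ^ (-m)
  set Y := ((1 + r) ^ 2) ^ (-m)
  have e4 : r / 2 - -1 - L * ((1 - Y) / (2 * r * m)) + ((2 - L) * ((X - 1) / (2 * r * m)) -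
      (1 - r / 2)) = (2 * m * r ^ 2 + 2 * (X - 1) - L * (X - Y)) / (2 * r * m) := by
    field_simp; ring
  rw [e4]
  exact div_nonpos_of_nonpos_of_nonneg (by linarith) (by positivity)

/-- Folding `s` with `-s` gives a function on `[0, 1]` that changes sign at most once, from negative
to positive. The weight decreases there, so the uniform inequality implies the weighted one. -/
theorem integral_abs_sub_one_weight {n : ℕ} (hn : 3 ≤ n) {q r : ℝ} (hq : 2 < q) (hr0 : 0 < r)
    (hr1 : r < 1) :
    ∫ s in (-1 : ℝ)..1, (|(1 + r ^ 2 - 2 * r * s) ^ (-q) - 1| + (1 + r ^ 2 - 2 * r * s) ^ (-q) -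
      (2 * (1 + r ^ 2) ^ q - (1 - r) ^ (2 * q)) * (1 + r ^ 2 - 2 * r * s) ^ (-q)) *
      weight n s ≤ 0 := by
  have hunif := integral_abs_sub_one_uniform hq hr0 hr1
  set L := 2 * (1 + r ^ 2) ^ q - (1 - r) ^ (2 * q) with hL
  set V : ℝ → ℝ := fun s => (1 + r ^ 2 - 2 * r * s) ^ (-q) with hV
  have hVc : ContinuousOn V (Icc (-1) 1) := continuousOn_one_add_sq_sub_rpow hr0.le hr1 _
  set f : ℝ → ℝ := fun s => |V s - 1| + V s - L * V s with hf
  have hfc : ContinuousOn f (Icc (-1) 1) := by fun_prop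
  change ∫ s in (-1 : ℝ)..1, f s ≤ 0 at hunif
  change ∫ s in (-1 : ℝ)..1, f s * weight n s ≤ 0
  rw [integral_symm_interval hfc] at hunif
  rw [integral_symm_interval (f := fun s => f s * weight n s) (hfc.mul (continuous_weight hn).continuousOn)]
  simp only [weight_neg, ← add_mul]
  have hsub : ∀ s ∈ Icc (0 : ℝ) 1, s ∈ Icc (-1 : ℝ) 1 := fun s hs => ⟨by linarith [hs.1], hs.2⟩
  have hsub' : ∀ s ∈ Icc (0 : ℝ) 1, -s ∈ Icc (-1 : ℝ) 1 := fun s hs =>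
    ⟨by linarith [hs.2], by linarith [hs.1]⟩
  have hpos : ∀ s ∈ Icc (-1 : ℝ) 1, 0 < V s := fun s hs =>
    Real.rpow_pos_of_pos (one_add_sq_sub_pos hr0.le hr1 hs) _
  have hmono : ∀ s ∈ Icc (-1 : ℝ) 1, ∀ t ∈ Icc (-1 : ℝ) 1, s ≤ t → V s ≤ V t := fun s hs t ht hst =>
    Real.rpow_le_rpow_of_nonpos (one_add_sq_sub_pos hr0.le hr1 ht) (by nlinarith) (by linarith)
  have hB1 : 1 ≤ (1 + r ^ 2) ^ q := Real.one_le_rpow (by nlinarith) (by linarith)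
  have hLB : (1 + r ^ 2) ^ q ≤ L := by
    have : (1 - r) ^ (2 * q) ≤ 1 := Real.rpow_le_one (by linarith) (by linarith) (by linarith)
    linarith
  have hV1 : ∀ s ∈ Icc (0 : ℝ) 1, V (-s) ≤ 1 := fun s hs =>
    Real.rpow_le_one_of_one_le_of_nonpos (by nlinarith [hs.1, mul_nonneg hr0.le hs.1])
      (by linarith)
  -- The inequality of arithmetic and geometric means, with `((1 + r²)² - 4r²s²) ≤ (1 + r²)²`
  -- bounding `V s * V (-s)` below.
  have hlow : ∀ s ∈ Icc (0 : ℝ) 1, 2 ≤ L * (V s + V (-s)) := by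
    intro s hs
    have hp := one_add_sq_sub_pos hr0.le hr1 (hsub s hs)
    have hp' := one_add_sq_sub_pos hr0.le hr1 (hsub' s hs)
    have h1 : ((1 + r ^ 2) ^ (-q)) ^ 2 ≤ V s * V (-s) := by
      rw [hV]
      simp only
      rw [← Real.mul_rpow hp.le hp'.le, sq, ← Real.mul_rpow (by positivity) (by positivity)]
      refine Real.rpow_le_rpow_of_nonpos (mul_pos hp hp') ?_ (by linarith)
      nlinarith [sq_nonneg (r * s)]
    have h2 : 2 * (1 + r ^ 2) ^ (-q) ≤ V s + V (-s) := by
      refine abs_le_of_sq_le_sq' ?_ (add_pos (hpos s (hsub s hs)) (hpos _ (hsub' s hs))).le |>.2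
      nlinarith [sq_nonneg (V s - V (-s))]
    have h3 : (1 + r ^ 2) ^ q * (1 + r ^ 2) ^ (-q) = 1 := by
      rw [← Real.rpow_add (by positivity)]; simp
    have h4 : 0 < (1 + r ^ 2) ^ (-q) := by positivity
    calc 2 = (1 + r ^ 2) ^ q * (2 * (1 + r ^ 2) ^ (-q)) := by linear_combination -2 * h3
      _ ≤ L * (V s + V (-s)) := mul_le_mul hLB h2 (by positivity) (by linarith)
  refine integral_mul_nonpos_of_single_crossing ?_ (continuous_weight hn).continuousOn
    (weight_antitoneOn hn) (fun s hs => weight_nonneg (hsub s hs)) ?_ hunif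
  · exact (hfc.mono fun s hs => hsub s hs).add (hfc.comp (by fun_prop) fun s hs => hsub' s hs)
  · intro s hs t ht hst hF
    simp only [hf] at hF ⊢
    have a1 := hV1 s hs
    have a2 := hV1 t ht
    rw [abs_of_nonpos (by linarith : V (-s) - 1 ≤ 0)] at hF
    rw [abs_of_nonpos (by linarith : V (-t) - 1 ≤ 0)]
    -- If `V s < 1`, the folded function is `2 - L * (V s + V (-s)) ≤ 0`. Hence positivity forces `V
    -- s ≥ 1`, where it equals `(2 - L) * V s - L * V (-s)`; positivity also forces `L < 2`, so it
    -- can only grow from there on.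
    have hVs : 1 ≤ V s := by
      by_contra hcon
      rw [abs_of_nonpos (by linarith)] at hF
      have := hlow s hs
      linarith
    have hst1 := hmono s (hsub s hs) t (hsub t ht) hst.le
    have hst2 := hmono (-t) (hsub' t ht) (-s) (hsub' s hs) (by linarith)
    rw [abs_of_nonneg (by linarith)] at hF ⊢
    have hL0 : 0 < L := by linarith
    have b1 := mul_le_mul_of_nonneg_left hst2 hL0.le
    have b2 : 0 < 2 - L := by
      have := mul_pos hL0 (hpos (-s) (hsub' s hs))
      by_contra hcon
      have := mul_nonneg_of_nonpos_of_nonpos (not_lt.1 hcon |> fun h => h) (by linarith : -V s ≤ 0)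
      linarith
    have b3 := mul_le_mul_of_nonneg_left hst1 b2.le
    linarith

/-- Since `A ≤ 1`, `|A V - 1| ≤ |V - 1| + (1 - A) V`, which reduces everything to `A = 1`. -/
theorem integral_abs_mul_sub_one_le {n : ℕ} (hn : 3 ≤ n) {q r A : ℝ} (hq : 2 < q) (hr0 : 0 < r)
    (hr1 : r < 1) (hA1 : A ≤ 1) :
    ∫ s in (-1 : ℝ)..1, |A * (1 + r ^ 2 - 2 * r * s) ^ (-q) - 1| * weight n s ≤
      (2 * (1 + r ^ 2) ^ q - (1 - r) ^ (2 * q) - A) *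
        ∫ s in (-1 : ℝ)..1, (1 + r ^ 2 - 2 * r * s) ^ (-q) * weight n s := by
  have h := integral_abs_sub_one_weight hn hq hr0 hr1
  set L := 2 * (1 + r ^ 2) ^ q - (1 - r) ^ (2 * q)
  set V : ℝ → ℝ := fun s => (1 + r ^ 2 - 2 * r * s) ^ (-q) with hV
  have hVc : ContinuousOn V (Icc (-1) 1) := continuousOn_one_add_sq_sub_rpow hr0.le hr1 _
  change ∫ s in (-1 : ℝ)..1, (|V s - 1| + V s - L * V s) * weight n s ≤ 0 at h
  change ∫ s in (-1 : ℝ)..1, |A * V s - 1| * weight n s ≤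
    (L - A) * ∫ s in (-1 : ℝ)..1, V s * weight n s
  rw [← sub_nonpos, ← intervalIntegral.integral_const_mul, ← intervalIntegral.integral_sub
    (intervalIntegrable_mul_weight hn (by fun_prop))
    ((intervalIntegrable_mul_weight hn hVc).const_mul _)]
  refine le_trans (intervalIntegral.integral_mono_on (by norm_num) ?_ ?_ ?_) h
  · exact (intervalIntegrable_mul_weight hn (by fun_prop)).sub
      ((intervalIntegrable_mul_weight hn hVc).const_mul _)
  · exact intervalIntegrable_mul_weight hn (f := fun s => |V s - 1| + V s - L * V s) (by fun_prop)
  · intro s hs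
    rw [← mul_assoc, ← sub_mul]
    refine mul_le_mul_of_nonneg_right ?_ (weight_nonneg hs)
    have hVp : 0 < V s := Real.rpow_pos_of_pos (one_add_sq_sub_pos hr0.le hr1 hs) _
    have h1 : |A * V s - 1| ≤ |V s - 1| + |(A - 1) * V s| := by
      have := abs_add_le (V s - 1) ((A - 1) * V s)
      rwa [show V s - 1 + (A - 1) * V s = A * V s - 1 by ring] at this
    rw [abs_of_nonpos (mul_nonpos_of_nonpos_of_nonneg (by linarith) hVp.le)] at h1
    linarith

/-- The estimate behind the third term of `G`. -/
theorem integral_sphere_abs_le_g {n : ℕ} (hn : 3 ≤ n) {α : ℝ} (hα : α < 1) {v : 𝔼 n} (hv : ‖v‖ = 1)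
    {r : ℝ} (hr0 : 0 < r) (hr1 : r < 1) :
    ∫ ζ, |(1 - r ^ 2) ^ (1 - α) *
        (1 + r ^ 2 - 2 * r * inner ℝ v (ζ : 𝔼 n)) ^ (-((n + 2 - α) / 2)) - 1| ∂(sphereMeasure n) ≤
      r * g n α r * ((1 - r ^ 2) ^ (α - 3) * hyperF₂ n α r) := by
  have hn' : (3 : ℝ) ≤ n := by exact_mod_cast hn
  have hκ := integral_weight_pos hn
  have hVc := continuousOn_one_add_sq_sub_rpow hr0.le hr1 (-((n + 2 - α) / 2))
  rw [← sphereMean_kernel_deriv hn α hr0.le hr1, sphereMean]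
  refine le_of_mul_le_mul_left ?_ hκ
  rw [integral_sphere_eq_integral_weight hn hv (f := fun s => |(1 - r ^ 2) ^ (1 - α) *
        (1 + r ^ 2 - 2 * r * s) ^ (-((n + 2 - α) / 2)) - 1|) (by fun_prop)]
  refine (integral_abs_mul_sub_one_le hn (by linarith) hr0 hr1
    (Real.rpow_le_one (by nlinarith) (by nlinarith) (by linarith))).trans_eq ?_
  -- With `q = (n + 2 - α) / 2` and `A = (1 - r²) ^ (1 - α)`, the factor in the bound is exactly the
  -- numerator `r * g r`.
  rw [g, if_neg hr0.ne', mul_div_cancel₀ _ hr0.ne', mul_left_comm, mul_inv_cancel_left₀ hκ.ne',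
    show 2 * ((n + 2 - α) / 2) = n + 2 - α by ring]

/-! ### The gradient of the kernel and differentiation under the integral -/

theorem normConst_pos {n : ℕ} (hn : 3 ≤ n) {α : ℝ} (hα : α < 1) : 0 < normConst n α := by
  have hn' : (3 : ℝ) ≤ n := by exact_mod_cast hn
  have h1 := Real.Gamma_pos_of_pos (show 0 < ((n : ℝ) - α) / 2 by linarith)
  have h2 := Real.Gamma_pos_of_pos (show 0 < 1 - α / 2 by linarith)
  have h3 := Real.Gamma_pos_of_pos (show 0 < (n : ℝ) / 2 by linarith)
  have h4 := Real.Gamma_pos_of_pos (show 0 < 1 - α by linarith)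
  rw [normConst]
  positivity

/-- The gradient of the Poisson–Szegő kernel in the first variable. -/
def kernelGrad {n : ℕ} (α : ℝ) (x ζ : 𝔼 n) : 𝔼 n :=
  normConst n α • ((-(2 * (1 - α)) * (1 - ‖x‖ ^ 2) ^ (-α) * (‖x - ζ‖ ^ 2) ^ (-(((n : ℝ) - α) / 2))) • x
    - (((n : ℝ) - α) * (1 - ‖x‖ ^ 2) ^ (1 - α) * (‖x - ζ‖ ^ 2) ^ (-(((n : ℝ) + 2 - α) / 2))) • (x - ζ))

theorem norm_sub_pos_of_mem_ball {n : ℕ} {x ζ : 𝔼 n} (hx : ‖x‖ < 1) (hζ : ‖ζ‖ = 1) :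
    0 < ‖x - ζ‖ := by
  rw [norm_pos_iff, sub_ne_zero]
  rintro rfl
  linarith

theorem hasFDerivAt_poissonKernel {n : ℕ} (α : ℝ) {x ζ : 𝔼 n} (hx : ‖x‖ < 1) (hζ : ‖ζ‖ = 1) :
    HasFDerivAt (fun x => poissonKernel α x ζ) (innerSL ℝ (kernelGrad α x ζ)) x := by
  have hN := norm_sub_pos_of_mem_ball hx hζ
  have hx2 : 0 < 1 - ‖x‖ ^ 2 := by nlinarith [norm_nonneg x]
  -- Powers of the squared norm, which is differentiable everywhere, replace powers of the norm.
  have e : (fun x => poissonKernel α x ζ) = fun x => normConst n α *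
      ((1 - ‖x‖ ^ 2) ^ (1 - α) * (‖x - ζ‖ ^ 2) ^ (-(((n : ℝ) - α) / 2))) := by
    ext x
    rw [poissonKernel, div_eq_mul_inv, ← Real.rpow_neg (norm_nonneg _), ← Real.rpow_natCast ‖x - ζ‖ 2,
      ← Real.rpow_mul (norm_nonneg (x - ζ))]
    congr 3; push_cast; ring
  rw [e]
  have h1 : HasFDerivAt (fun x : 𝔼 n => 1 - ‖x‖ ^ 2) (-(2 • innerSL ℝ x)) x := by
    have := (hasStrictFDerivAt_norm_sq x).hasFDerivAt.const_sub (1 : ℝ)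
    exact this
  have h2 : HasFDerivAt (fun x : 𝔼 n => ‖x - ζ‖ ^ 2) (2 • innerSL ℝ (x - ζ)) x := by
    have := (hasStrictFDerivAt_norm_sq (x - ζ)).hasFDerivAt.comp x
      ((hasFDerivAt_id x).sub_const ζ)
    exact this
  refine (((h1.rpow_const (p := 1 - α) (Or.inl hx2.ne')).mul
    (h2.rpow_const (p := -(((n : ℝ) - α) / 2)) (Or.inl (by positivity)))).const_mul
      (normConst n α)).congr_fderiv ?_
  ext v
  simp only [kernelGrad, map_smul, map_sub, _root_.smul_apply,
    _root_.add_apply, _root_.sub_apply, _root_.neg_apply,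
    innerSL_apply_apply, smul_eq_mul, nsmul_eq_mul, smul_sub, smul_add,
    show 1 - α - 1 = -α by ring, show -(((n : ℝ) - α) / 2) - 1 = -((n + 2 - α) / 2) by ring]
  push_cast
  ring

/-- Joint continuity gives a bound uniform in `ζ` and in `x` on smaller closed balls, the dominating
constant for differentiation under the integral. -/
theorem continuousOn_kernelGrad {n : ℕ} (α : ℝ) :
    ContinuousOn (fun p : (𝔼 n) × (𝔼 n) => kernelGrad α p.1 p.2) (ball 0 1 ×ˢ sphere 0 1) := by
  have h1 : ∀ p ∈ (ball 0 1 ×ˢ sphere 0 1 : Set ((𝔼 n) × (𝔼 n))), 1 - ‖p.1‖ ^ 2 ≠ 0 := by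
    intro p hp
    have := mem_ball_zero_iff.1 hp.1
    nlinarith [norm_nonneg p.1]
  have h2 : ∀ p ∈ (ball 0 1 ×ˢ sphere 0 1 : Set ((𝔼 n) × (𝔼 n))), ‖p.1 - p.2‖ ^ 2 ≠ 0 := by
    intro p hp
    have := norm_sub_pos_of_mem_ball (mem_ball_zero_iff.1 hp.1) (mem_sphere_zero_iff_norm.1 hp.2)
    positivity
  have c1 : ∀ b : ℝ, ContinuousOn (fun p : (𝔼 n) × (𝔼 n) => (1 - ‖p.1‖ ^ 2) ^ b)
      (ball 0 1 ×ˢ sphere 0 1) := fun b =>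
    ContinuousOn.rpow_const (by fun_prop) fun p hp => Or.inl (h1 p hp)
  have c2 : ∀ b : ℝ, ContinuousOn (fun p : (𝔼 n) × (𝔼 n) => (‖p.1 - p.2‖ ^ 2) ^ b)
      (ball 0 1 ×ˢ sphere 0 1) := fun b =>
    ContinuousOn.rpow_const (by fun_prop) fun p hp => Or.inl (h2 p hp)
  unfold kernelGrad
  exact ((((continuousOn_const.mul (c1 _)).mul (c2 _)).smul continuousOn_fst).sub
      (((continuousOn_const.mul (c1 _)).mul (c2 _)).smul
        (continuousOn_fst.sub continuousOn_snd))).const_smul (normConst n α)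

theorem continuous_kernelGrad_sphere {n : ℕ} (α : ℝ) {x : 𝔼 n} (hx : ‖x‖ < 1) :
    Continuous fun ζ : sphere (0 : 𝔼 n) 1 => kernelGrad α x (ζ : 𝔼 n) :=
  (continuousOn_kernelGrad α).comp_continuous (f := fun ζ : sphere (0 : 𝔼 n) 1 => (x, (ζ : 𝔼 n)))
    (by fun_prop) fun ζ => ⟨mem_ball_zero_iff.2 hx, ζ.2⟩

theorem continuous_poissonKernel_sphere {n : ℕ} (α : ℝ) {x : 𝔼 n} (hx : ‖x‖ < 1) :
    Continuous fun ζ : sphere (0 : 𝔼 n) 1 => poissonKernel α x (ζ : 𝔼 n) := by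
  unfold poissonKernel
  have hN : ∀ ζ : sphere (0 : 𝔼 n) 1, 0 < ‖x - (ζ : 𝔼 n)‖ := fun ζ =>
    norm_sub_pos_of_mem_ball hx (norm_eq_of_mem_sphere ζ)
  refine continuous_const.mul (continuous_const.div ?_ fun ζ => (Real.rpow_pos_of_pos (hN ζ) _).ne')
  exact Continuous.rpow_const (by fun_prop) fun ζ => Or.inl (hN ζ).ne'

theorem ae_norm_le {n : ℕ} {M : ℝ} {φ : sphere (0 : 𝔼 n) 1 → 𝔼 n} (hM : 0 ≤ M)
    (hφM : eLpNorm φ ⊤ (sphereMeasure n) ≤ ENNReal.ofReal M) :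
    ∀ᵐ ζ ∂(sphereMeasure n), ‖φ ζ‖ ≤ M := by
  rw [eLpNorm_exponent_top] at hφM
  filter_upwards [ae_le_eLpNormEssSup (f := φ) (μ := sphereMeasure n)] with ζ hζ
  have := hζ.trans hφM
  rwa [← ofReal_norm, ENNReal.ofReal_le_ofReal_iff hM] at this

/-- The derivative of the Poisson–Szegő integral, as an integral. -/
def poissonDeriv {n : ℕ} (α : ℝ) (φ : sphere (0 : 𝔼 n) 1 → 𝔼 n) (x : 𝔼 n) : (𝔼 n) →L[ℝ] 𝔼 n :=
  ∫ ζ, (innerSL ℝ (kernelGrad α x (ζ : 𝔼 n))).smulRight (φ ζ) ∂(sphereMeasure n)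

theorem norm_innerSL_smulRight {n : ℕ} (a b : 𝔼 n) : ‖(innerSL ℝ a).smulRight b‖ = ‖a‖ * ‖b‖ := by
  rw [ContinuousLinearMap.norm_smulRight_apply, innerSL_apply_norm]

theorem aestronglyMeasurable_smulRight_of_dual {X E : Type*} [MeasurableSpace X] {μ : Measure X}
    [NormedAddCommGroup E] [NormedSpace ℝ E] {L : X → E →L[ℝ] ℝ} {φ : X → E}
    (hL : AEStronglyMeasurable L μ) (hφ : AEStronglyMeasurable φ μ) :
    AEStronglyMeasurable (fun ζ => (L ζ).smulRight (φ ζ)) μ := by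
  have h1 : Continuous fun p : (E →L[ℝ] ℝ) × E => p.1.smulRight p.2 :=
    (isBoundedBilinearMap_smulRight (𝕜 := ℝ) (E := E) (F := E)).continuous
  have h3 : AEStronglyMeasurable (fun ζ => (L ζ, φ ζ)) μ := hL.prodMk hφ
  exact h1.comp_aestronglyMeasurable h3

theorem aestronglyMeasurable_smulRight {n : ℕ} {φ : sphere (0 : 𝔼 n) 1 → 𝔼 n}
    (hφ : AEStronglyMeasurable φ (sphereMeasure n)) {f : sphere (0 : 𝔼 n) 1 → 𝔼 n}
    (hf : Continuous f) :
    AEStronglyMeasurable (fun ζ => (innerSL ℝ (f ζ)).smulRight (φ ζ)) (sphereMeasure n) := by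
  have h2 : Continuous fun ζ => innerSL ℝ (f ζ) := (innerSL ℝ).continuous.comp hf
  exact aestronglyMeasurable_smulRight_of_dual h2.aestronglyMeasurable hφ

theorem integrable_smulRight {n : ℕ} [NeZero n] {M : ℝ} {φ : sphere (0 : 𝔼 n) 1 → 𝔼 n}
    (hφ : AEStronglyMeasurable φ (sphereMeasure n)) (hb : ∀ᵐ ζ ∂(sphereMeasure n), ‖φ ζ‖ ≤ M)
    {f : sphere (0 : 𝔼 n) 1 → 𝔼 n} (hf : Continuous f) :
    Integrable (fun ζ => (innerSL ℝ (f ζ)).smulRight (φ ζ)) (sphereMeasure n) := by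
  obtain ⟨B, hB⟩ := isCompact_univ.exists_bound_of_continuousOn hf.continuousOn
  refine Integrable.of_bound (C := B * M) (aestronglyMeasurable_smulRight hφ hf) ?_
  filter_upwards [hb] with ζ hζ
  rw [norm_innerSL_smulRight]
  exact mul_le_mul (hB ζ (mem_univ _)) hζ (norm_nonneg _) ((norm_nonneg _).trans (hB ζ (mem_univ _)))

theorem hasFDerivAt_poissonIntegral {n : ℕ} [NeZero n] (α : ℝ) {M : ℝ}
    {φ : sphere (0 : 𝔼 n) 1 → 𝔼 n} (hφ : AEStronglyMeasurable φ (sphereMeasure n))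
    (hb : ∀ᵐ ζ ∂(sphereMeasure n), ‖φ ζ‖ ≤ M) {x : 𝔼 n} (hx : ‖x‖ < 1) :
    HasFDerivAt (poissonIntegral α φ) (poissonDeriv α φ x) x := by
  obtain ⟨ρ, hxρ, hρ1⟩ := exists_between hx
  have hcomp : IsCompact (closedBall (0 : 𝔼 n) ρ ×ˢ sphere (0 : 𝔼 n) 1) :=
    (isCompact_closedBall _ _).prod (isCompact_sphere _ _)
  obtain ⟨B, hB⟩ := hcomp.exists_bound_of_continuousOn
    ((continuousOn_kernelGrad α).mono (prod_mono (closedBall_subset_ball hρ1) le_rfl))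
  have hs : ball (0 : 𝔼 n) ρ ∈ nhds x := isOpen_ball.mem_nhds (mem_ball_zero_iff.2 hxρ)
  have hmeas : ∀ y : 𝔼 n, ‖y‖ < 1 → AEStronglyMeasurable
      (fun ζ : sphere (0 : 𝔼 n) 1 => poissonKernel α y (ζ : 𝔼 n) • φ ζ) (sphereMeasure n) :=
    fun y hy => (continuous_poissonKernel_sphere α hy).aestronglyMeasurable.smul hφ
  refine hasFDerivAt_integral_of_dominated_of_fderiv_le (𝕜 := ℝ) (μ := sphereMeasure n) (x₀ := x)
    (F := fun y (ζ : sphere (0 : 𝔼 n) 1) => poissonKernel α y (ζ : 𝔼 n) • φ ζ)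
    (F' := fun y (ζ : sphere (0 : 𝔼 n) 1) =>
      (innerSL ℝ (kernelGrad α y (ζ : 𝔼 n))).smulRight (φ ζ))
    (bound := fun _ => B * M) hs ?_ ?_ ?_ ?_ ?_ ?_
  · filter_upwards [hs] with y hy
    exact hmeas y ((mem_ball_zero_iff.1 hy).trans hρ1)
  · obtain ⟨B', hB'⟩ := isCompact_univ.exists_bound_of_continuousOn
      (continuous_poissonKernel_sphere α hx).continuousOn
    refine Integrable.of_bound (C := B' * M) (hmeas x hx) ?_
    filter_upwards [hb] with ζ hζ
    rw [norm_smul]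
    exact mul_le_mul (hB' ζ (mem_univ _)) hζ (norm_nonneg _)
      ((norm_nonneg _).trans (hB' ζ (mem_univ _)))
  · exact aestronglyMeasurable_smulRight hφ (continuous_kernelGrad_sphere α hx)
  · filter_upwards [hb] with ζ hζ y hy
    have h1 := hB (y, (ζ : 𝔼 n)) ⟨ball_subset_closedBall hy, ζ.2⟩
    rw [norm_innerSL_smulRight]
    exact mul_le_mul h1 hζ (norm_nonneg _) ((norm_nonneg _).trans h1)
  · exact integrable_const _
  · filter_upwards with ζ y hy
    exact (hasFDerivAt_poissonKernel α ((mem_ball_zero_iff.1 hy).trans hρ1)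
      (norm_eq_of_mem_sphere ζ)).smul_const (φ ζ)

/-! ### Estimates for the derivative -/

theorem kernelGrad_zero {n : ℕ} (α : ℝ) {ζ : 𝔼 n} (hζ : ‖ζ‖ = 1) :
    kernelGrad α 0 ζ = (normConst n α * (n - α)) • ζ := by
  simp [kernelGrad, hζ, smul_smul]

/-- The operator norm of the derivative at the origin. -/
theorem norm_poissonDeriv_zero_le {n : ℕ} (hn : 3 ≤ n) {α : ℝ} (hα : α < 1) {M : ℝ} (hM : 0 ≤ M)
    {φ : sphere (0 : 𝔼 n) 1 → 𝔼 n} (hφ : AEStronglyMeasurable φ (sphereMeasure n))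
    (hb : ∀ᵐ ζ ∂(sphereMeasure n), ‖φ ζ‖ ≤ M) :
    ‖poissonDeriv α φ 0‖ ≤ M * (((n : ℝ) - α) * normConst n α * Real.Gamma ((n : ℝ) / 2) /
      (Real.sqrt Real.pi * Real.Gamma (((n : ℝ) + 1) / 2))) := by
  have : NeZero n := ⟨by omega⟩
  have hn' : (3 : ℝ) ≤ n := by exact_mod_cast hn
  have hC := normConst_pos hn hα
  have hG1 : 0 < Real.Gamma ((n : ℝ) / 2) := Real.Gamma_pos_of_pos (by linarith)
  have hG2 : 0 < Real.Gamma (((n : ℝ) + 1) / 2) := Real.Gamma_pos_of_pos (by linarith)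
  have hnα : 0 < (n : ℝ) - α := by linarith
  refine ContinuousLinearMap.opNorm_le_of_unit_norm (by positivity) fun v hv => ?_
  have hi := integrable_smulRight hφ hb
    (continuous_kernelGrad_sphere α (x := (0 : 𝔼 n)) (by simp))
  rw [poissonDeriv, ContinuousLinearMap.integral_apply hi]
  have hint := integrable_comp_inner_sphere (n := n) hv (f := fun s => |s|) (by fun_prop)
  calc ‖∫ ζ, (innerSL ℝ (kernelGrad α 0 (ζ : 𝔼 n))).smulRight (φ ζ) v ∂(sphereMeasure n)‖
      ≤ ∫ ζ, M * (((n : ℝ) - α) * normConst n α) * |inner ℝ v (ζ : 𝔼 n)| ∂(sphereMeasure n) := by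
        refine norm_integral_le_of_norm_le (hint.const_mul _) ?_
        filter_upwards [hb] with ζ hζ
        rw [ContinuousLinearMap.smulRight_apply, norm_smul, kernelGrad_zero α (norm_eq_of_mem_sphere ζ),
          innerSL_apply_apply, inner_smul_left, Real.norm_eq_abs, abs_mul, real_inner_comm]
        simp only [conj_trivial]
        rw [abs_of_pos (by positivity : 0 < normConst n α * ((n : ℝ) - α))]
        calc _ ≤ normConst n α * ((n : ℝ) - α) * |inner ℝ v (ζ : 𝔼 n)| * M := by gcongr
          _ = _ := by ring
    _ = _ := by
        rw [integral_const_mul, integral_sphere_abs (by omega) hv]; ring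

/-- In the second part of the gradient `x - ζ` is separated into `x` and `ζ`, and the `ζ` part is
combined with the gradient at `0`. The three summands become the three terms of `G`; only the last
has no visible factor `‖x‖`, which `integral_sphere_abs_le_g` supplies. -/
theorem norm_kernelGrad_sub_le {n : ℕ} (hn : 3 ≤ n) {α : ℝ} (hα : α < 1) {x ζ : 𝔼 n} (hx : ‖x‖ < 1)
    (hζ : ‖ζ‖ = 1) :
    ‖kernelGrad α x ζ - kernelGrad α 0 ζ‖ ≤ normConst n α *
      (2 * (1 - α) * (1 - ‖x‖ ^ 2) ^ (-α) * ‖x‖ * (‖x - ζ‖ ^ 2) ^ (-(((n : ℝ) - α) / 2)) +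
      ((n : ℝ) - α) * (1 - ‖x‖ ^ 2) ^ (1 - α) * ‖x‖ * (‖x - ζ‖ ^ 2) ^ (-(((n : ℝ) + 2 - α) / 2)) +
      ((n : ℝ) - α) *
        |(1 - ‖x‖ ^ 2) ^ (1 - α) * (‖x - ζ‖ ^ 2) ^ (-(((n : ℝ) + 2 - α) / 2)) - 1|) := by
  have hn' : (3 : ℝ) ≤ n := by exact_mod_cast hn
  have hC := normConst_pos hn hα
  have hx2 : 0 < 1 - ‖x‖ ^ 2 := by nlinarith [norm_nonneg x]
  have hnα : 0 < (n : ℝ) - α := by linarith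
  have hα' : 0 < 1 - α := by linarith
  rw [kernelGrad_zero α hζ, kernelGrad]
  set P := (‖x - ζ‖ ^ 2) ^ (-(((n : ℝ) - α) / 2))
  set Q := (‖x - ζ‖ ^ 2) ^ (-(((n : ℝ) + 2 - α) / 2))
  set A := (1 - ‖x‖ ^ 2) ^ (1 - α)
  set A' := (1 - ‖x‖ ^ 2) ^ (-α)
  have hP : 0 ≤ P := by positivity
  have hQ : 0 ≤ Q := by positivity
  have hA : 0 < A := Real.rpow_pos_of_pos hx2 _
  have hA' : 0 < A' := Real.rpow_pos_of_pos hx2 _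
  have e : normConst n α • ((-(2 * (1 - α)) * A' * P) • x - (((n : ℝ) - α) * A * Q) • (x - ζ)) -
      (normConst n α * (n - α)) • ζ = normConst n α • ((-(2 * (1 - α)) * A' * P) • x +
        (-((n : ℝ) - α) * A * Q) • x + (((n : ℝ) - α) * (A * Q - 1)) • ζ) := by
    module
  rw [e, norm_smul, Real.norm_eq_abs, abs_of_pos hC]
  refine mul_le_mul_of_nonneg_left ((norm_add₃_le).trans_eq ?_) hC.le
  rw [norm_smul, norm_smul, norm_smul, hζ, mul_one, Real.norm_eq_abs, Real.norm_eq_abs,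
    Real.norm_eq_abs, abs_mul ((n : ℝ) - α) (A * Q - 1), abs_of_pos hnα,
    show -(2 * (1 - α)) * A' * P = -(2 * (1 - α) * A' * P) by ring, abs_neg,
    abs_of_nonneg (by positivity : 0 ≤ 2 * (1 - α) * A' * P),
    show -((n : ℝ) - α) * A * Q = -(((n : ℝ) - α) * A * Q) by ring, abs_neg,
    abs_of_nonneg (by positivity : 0 ≤ ((n : ℝ) - α) * A * Q)]
  ring

/-- The value at `r` of the function whose terms are maximized in `G`. -/
def preG (n : ℕ) (α r : ℝ) : ℝ :=
  2 * (1 - α) * normConst n α * hyperF₁ n α r * (1 / (1 - r ^ 2))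
  + ((n : ℝ) - α) * normConst n α * hyperF₂ n α r * (1 / (1 - r ^ 2) ^ 2)
  + ((n : ℝ) - α) * normConst n α * (hyperF₂ n α r * g n α r) * (1 / (1 - r ^ 2) ^ (3 - α))

/-- By rotation only the coordinate of `ζ` along `x / ‖x‖` matters; the means are `F₁` and `F₂` up
to powers of `1 - r ^ 2`, and the third term is the inequality with `g`. -/
theorem integral_norm_kernelGrad_sub_le {n : ℕ} (hn : 3 ≤ n) {α : ℝ} (hα : α < 1) {x : 𝔼 n}
    (hx : ‖x‖ < 1) :
    ∫ ζ, ‖kernelGrad α x (ζ : sphere (0 : 𝔼 n) 1) - kernelGrad α 0 (ζ : 𝔼 n)‖ ∂(sphereMeasure n) ≤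
      ‖x‖ * preG n α ‖x‖ := by
  have : NeZero n := ⟨by omega⟩
  rcases eq_or_ne x 0 with rfl | hx0
  · simp
  have hn' : (3 : ℝ) ≤ n := by exact_mod_cast hn
  have hC := normConst_pos hn hα
  have hr0 : 0 < ‖x‖ := norm_pos_iff.2 hx0
  set r := ‖x‖ with hr
  have hx2 : 0 < 1 - r ^ 2 := by nlinarith
  have hnα : 0 < (n : ℝ) - α := by linarith
  set v : 𝔼 n := r⁻¹ • x with hv
  have hv1 : ‖v‖ = 1 := by
    rw [hv, norm_smul, norm_inv, norm_norm, ← hr, inv_mul_cancel₀ hr0.ne']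
  have hxv : x = r • v := by rw [hv, smul_smul, mul_inv_cancel₀ hr0.ne', one_smul]
  have hN : ∀ ζ : sphere (0 : 𝔼 n) 1, ‖x - (ζ : 𝔼 n)‖ ^ 2 =
      1 + r ^ 2 - 2 * r * inner ℝ v (ζ : 𝔼 n) := by
    intro ζ
    have h1 : ‖x - (ζ : 𝔼 n)‖ ^ 2 = ‖x‖ ^ 2 - 2 * inner ℝ x (ζ : 𝔼 n) + ‖(ζ : 𝔼 n)‖ ^ 2 :=
      norm_sub_sq_real _ _
    rw [h1, norm_eq_of_mem_sphere]
    conv_lhs => rw [hxv, inner_smul_left]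
    rw [← hxv, ← hr]
    simp only [conj_trivial]
    ring
  have c1 := continuousOn_one_add_sq_sub_rpow hr0.le hx (-(((n : ℝ) - α) / 2))
  have c2 := continuousOn_one_add_sq_sub_rpow hr0.le hx (-(((n : ℝ) + 2 - α) / 2))
  have i1 := (integrable_comp_inner_sphere hv1 c1).const_mul (2 * (1 - α) * (1 - r ^ 2) ^ (-α) * r)
  have i2 := (integrable_comp_inner_sphere hv1 c2).const_mul
    (((n : ℝ) - α) * (1 - r ^ 2) ^ (1 - α) * r)
  have i3 := (integrable_comp_inner_sphere hv1 (f := fun s => |(1 - r ^ 2) ^ (1 - α) *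
    (1 + r ^ 2 - 2 * r * s) ^ (-(((n : ℝ) + 2 - α) / 2)) - 1|) (by fun_prop)).const_mul ((n : ℝ) - α)
  have hle : ∀ ζ : sphere (0 : 𝔼 n) 1, ‖kernelGrad α x (ζ : 𝔼 n) - kernelGrad α 0 (ζ : 𝔼 n)‖ ≤
      normConst n α * (2 * (1 - α) * (1 - r ^ 2) ^ (-α) * r *
        (1 + r ^ 2 - 2 * r * inner ℝ v (ζ : 𝔼 n)) ^ (-(((n : ℝ) - α) / 2)) +
      ((n : ℝ) - α) * (1 - r ^ 2) ^ (1 - α) * r *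
        (1 + r ^ 2 - 2 * r * inner ℝ v (ζ : 𝔼 n)) ^ (-(((n : ℝ) + 2 - α) / 2)) +
      ((n : ℝ) - α) * |(1 - r ^ 2) ^ (1 - α) *
        (1 + r ^ 2 - 2 * r * inner ℝ v (ζ : 𝔼 n)) ^ (-(((n : ℝ) + 2 - α) / 2)) - 1|) := by
    intro ζ
    have := norm_kernelGrad_sub_le hn hα hx (norm_eq_of_mem_sphere ζ)
    rwa [hN ζ] at this
  have e12 : Integrable (fun ζ : sphere (0 : 𝔼 n) 1 => 2 * (1 - α) * (1 - r ^ 2) ^ (-α) * r *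
        (1 + r ^ 2 - 2 * r * inner ℝ v (ζ : 𝔼 n)) ^ (-(((n : ℝ) - α) / 2)) +
      ((n : ℝ) - α) * (1 - r ^ 2) ^ (1 - α) * r *
        (1 + r ^ 2 - 2 * r * inner ℝ v (ζ : 𝔼 n)) ^ (-(((n : ℝ) + 2 - α) / 2)))
      (sphereMeasure n) := i1.add i2
  have i123 : Integrable (fun ζ : sphere (0 : 𝔼 n) 1 => 2 * (1 - α) * (1 - r ^ 2) ^ (-α) * r *
        (1 + r ^ 2 - 2 * r * inner ℝ v (ζ : 𝔼 n)) ^ (-(((n : ℝ) - α) / 2)) +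
      ((n : ℝ) - α) * (1 - r ^ 2) ^ (1 - α) * r *
        (1 + r ^ 2 - 2 * r * inner ℝ v (ζ : 𝔼 n)) ^ (-(((n : ℝ) + 2 - α) / 2)) +
      ((n : ℝ) - α) * |(1 - r ^ 2) ^ (1 - α) *
        (1 + r ^ 2 - 2 * r * inner ℝ v (ζ : 𝔼 n)) ^ (-(((n : ℝ) + 2 - α) / 2)) - 1|)
      (sphereMeasure n) := e12.add i3
  refine (integral_mono_of_nonneg (Filter.Eventually.of_forall fun _ => norm_nonneg _)
    (i123.const_mul (normConst n α)) (Filter.Eventually.of_forall hle)).trans ?_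
  rw [integral_const_mul, integral_add e12 i3, integral_add i1 i2, integral_const_mul,
    integral_const_mul, integral_const_mul, integral_sphere_eq_sphereMean hn hv1 hr0.le hx,
    integral_sphere_eq_sphereMean hn hv1 hr0.le hx, sphereMean_kernel hn α hr0.le hx,
    sphereMean_kernel_deriv hn α hr0.le hx]
  have h3 := integral_sphere_abs_le_g hn hα hv1 hr0 hx
  have h4 := mul_le_mul_of_nonneg_left h3 (mul_nonneg hC.le hnα.le)
  have p1 : (1 - r ^ 2) ^ (-α) * (1 - r ^ 2) ^ (α - 1) = 1 / (1 - r ^ 2) := by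
    rw [← Real.rpow_add hx2, show -α + (α - 1) = -1 by ring, Real.rpow_neg_one, one_div]
  have p2 : (1 - r ^ 2) ^ (1 - α) * (1 - r ^ 2) ^ (α - 3) = 1 / (1 - r ^ 2) ^ 2 := by
    rw [← Real.rpow_add hx2, show 1 - α + (α - 3) = -((2 : ℕ) : ℝ) by push_cast; ring,
      Real.rpow_neg hx2.le, Real.rpow_natCast, one_div]
  have p3 : (1 - r ^ 2) ^ (α - 3) = 1 / (1 - r ^ 2) ^ (3 - α) := by
    rw [one_div, ← Real.rpow_neg hx2.le, neg_sub]
  rw [p3] at h4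
  rw [preG]
  calc _ = normConst n α * (2 * (1 - α) * r * hyperF₁ n α r *
          ((1 - r ^ 2) ^ (-α) * (1 - r ^ 2) ^ (α - 1)) + ((n : ℝ) - α) * r * hyperF₂ n α r *
          ((1 - r ^ 2) ^ (1 - α) * (1 - r ^ 2) ^ (α - 3))) + normConst n α * ((n : ℝ) - α) *
          ∫ ζ, |(1 - r ^ 2) ^ (1 - α) * (1 + r ^ 2 - 2 * r * inner ℝ v (ζ : 𝔼 n)) ^
            (-(((n : ℝ) + 2 - α) / 2)) - 1| ∂(sphereMeasure n) := by ring
    _ ≤ _ := by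
        rw [p1, p2]
        refine (add_le_add_right h4 _).trans_eq ?_
        ring

theorem norm_poissonDeriv_sub_le {n : ℕ} (hn : 3 ≤ n) {α : ℝ} (hα : α < 1) {M : ℝ} (hM : 0 ≤ M)
    {φ : sphere (0 : 𝔼 n) 1 → 𝔼 n} (hφ : AEStronglyMeasurable φ (sphereMeasure n))
    (hb : ∀ᵐ ζ ∂(sphereMeasure n), ‖φ ζ‖ ≤ M) {x : 𝔼 n} (hx : ‖x‖ < 1) :
    ‖poissonDeriv α φ x - poissonDeriv α φ 0‖ ≤ M * (‖x‖ * preG n α ‖x‖) := by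
  have : NeZero n := ⟨by omega⟩
  have c1 := continuous_kernelGrad_sphere α hx
  have c0 := continuous_kernelGrad_sphere α (x := (0 : 𝔼 n)) (by simp)
  rw [poissonDeriv, poissonDeriv, ← integral_sub (integrable_smulRight hφ hb c1)
    (integrable_smulRight hφ hb c0)]
  have hint : Integrable (fun ζ : sphere (0 : 𝔼 n) 1 =>
      ‖kernelGrad α x (ζ : 𝔼 n) - kernelGrad α 0 (ζ : 𝔼 n)‖) (sphereMeasure n) :=
    (c1.sub c0).norm.integrable_of_hasCompactSupport (HasCompactSupport.of_compactSpace _)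
  refine (norm_integral_le_of_norm_le (hint.const_mul M) ?_).trans ?_
  · filter_upwards [hb] with ζ hζ
    have e : (innerSL ℝ (kernelGrad α x (ζ : 𝔼 n))).smulRight (φ ζ) -
        (innerSL ℝ (kernelGrad α 0 (ζ : 𝔼 n))).smulRight (φ ζ) =
        (innerSL ℝ (kernelGrad α x (ζ : 𝔼 n) - kernelGrad α 0 (ζ : 𝔼 n))).smulRight (φ ζ) := by
      ext w
      simp [sub_smul]
    rw [e, norm_innerSL_smulRight, mul_comm]
    gcongr
  · rw [integral_const_mul]
    exact mul_le_mul_of_nonneg_left (integral_norm_kernelGrad_sub_le hn hα hx) hM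

/-! ### Continuity, running maxima and the behaviour of `G` -/

theorem continuousOn_hyperF₁ {n : ℕ} (hn : 3 ≤ n) (α : ℝ) : ContinuousOn (hyperF₁ n α) (Ico 0 1) := by
  have hn' : (3 : ℝ) ≤ n := by exact_mod_cast hn
  refine (analyticOnNhd_ordinaryHypergeometric _ _ (by linarith)).continuousOn.comp
    (f := fun t : ℝ => t ^ 2) (by fun_prop) fun t ht => ?_
  rw [mem_ball_zero_iff, Real.norm_eq_abs, abs_of_nonneg (sq_nonneg t)]
  nlinarith [ht.1, ht.2]

theorem continuousOn_hyperF₂ {n : ℕ} (hn : 3 ≤ n) (α : ℝ) : ContinuousOn (hyperF₂ n α) (Ico 0 1) := by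
  have hn' : (3 : ℝ) ≤ n := by exact_mod_cast hn
  refine (analyticOnNhd_ordinaryHypergeometric _ _ (by linarith)).continuousOn.comp
    (f := fun t : ℝ => t ^ 2) (by fun_prop) fun t ht => ?_
  rw [mem_ball_zero_iff, Real.norm_eq_abs, abs_of_nonneg (sq_nonneg t)]
  nlinarith [ht.1, ht.2]

/-- The numerator vanishes at `0` with derivative `n + 2 - α`, so `g` is its difference quotient at
`0`, completed by that derivative. -/
theorem continuousOn_g (n : ℕ) (α : ℝ) : ContinuousOn (g n α) (Ico 0 1) := by
  set h : ℝ → ℝ := fun r => 2 * (1 + r ^ 2) ^ (((n : ℝ) + 2 - α) / 2) -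
    (1 - r) ^ ((n : ℝ) + 2 - α) - (1 - r ^ 2) ^ (1 - α) with hh
  have hd : HasDerivAt h ((n : ℝ) + 2 - α) 0 := by
    have d1 : HasDerivAt (fun r : ℝ => 1 + r ^ 2) 0 0 := by
      simpa using ((hasDerivAt_id (0 : ℝ)).pow 2).const_add 1
    have d2 : HasDerivAt (fun r : ℝ => 1 - r ^ 2) 0 0 := by
      simpa using ((hasDerivAt_id (0 : ℝ)).pow 2).const_sub 1
    have d3 : HasDerivAt (fun r : ℝ => 1 - r) (-1) 0 := by
      simpa using (hasDerivAt_id (0 : ℝ)).const_sub 1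
    have := (((d1.rpow_const (p := ((n : ℝ) + 2 - α) / 2) (Or.inl (by norm_num))).const_mul 2).sub
      (d3.rpow_const (p := (n : ℝ) + 2 - α) (Or.inl (by norm_num)))).sub
      (d2.rpow_const (p := 1 - α) (Or.inl (by norm_num)))
    refine this.congr_deriv ?_
    norm_num
  have hg : g n α = dslope h 0 := by
    ext r
    rw [g]
    split_ifs with h0
    · rw [h0, dslope_same, hd.deriv]
    · rw [dslope_of_ne _ h0, slope_def_field]
      simp only [hh]
      norm_num
  rw [hg]
  intro r hr
  rcases eq_or_ne r 0 with rfl | h0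
  · exact (continuousAt_dslope_same.2 hd.differentiableAt).continuousWithinAt
  · refine ((continuousAt_dslope_of_ne h0).2 ?_).continuousWithinAt
    have h1 : 0 < 1 - r := by linarith [hr.2]
    have h2 : 0 < 1 - r ^ 2 := by nlinarith [hr.1]
    exact ((continuousAt_const.mul ((by fun_prop : ContinuousAt (fun r : ℝ => 1 + r ^ 2) r).rpow_const
      (Or.inl (by positivity)))).sub ((by fun_prop : ContinuousAt (fun r : ℝ => 1 - r) r).rpow_const
      (Or.inl h1.ne'))).sub ((by fun_prop : ContinuousAt (fun r : ℝ => 1 - r ^ 2) r).rpow_const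
      (Or.inl h2.ne'))

section RunningMax

variable {f : ℝ → ℝ}

theorem bddAbove_image_Icc_of_Ico (hf : ContinuousOn f (Ico 0 1)) {r : ℝ} (hr : r < 1) :
    BddAbove (f '' Icc 0 r) :=
  isCompact_Icc.bddAbove_image (hf.mono fun _ ht => ⟨ht.1, ht.2.trans_lt hr⟩)

theorem le_runningMax (hf : ContinuousOn f (Ico 0 1)) {t r : ℝ} (ht : 0 ≤ t) (htr : t ≤ r)
    (hr : r < 1) : f t ≤ sSup (f '' Icc 0 r) :=
  le_csSup (bddAbove_image_Icc_of_Ico hf hr) ⟨t, ⟨ht, htr⟩, rfl⟩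

theorem runningMax_mono (hf : ContinuousOn f (Ico 0 1)) {r s : ℝ} (hr : 0 ≤ r) (hrs : r ≤ s)
    (hs : s < 1) : sSup (f '' Icc 0 r) ≤ sSup (f '' Icc 0 s) :=
  csSup_le_csSup (bddAbove_image_Icc_of_Ico hf hs) ((nonempty_Icc.2 hr).image f)
    (image_mono (Icc_subset_Icc_right hrs))

/-- Rescaling `t` to `r * t` turns the moving interval into the fixed compact `[0, 1]`, over which a
supremum of a jointly continuous function is continuous. -/
theorem continuousOn_runningMax (hf : ContinuousOn f (Ico 0 1)) :
    ContinuousOn (fun r => sSup (f '' Icc 0 r)) (Ico 0 1) := by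
  intro r hr
  obtain ⟨b, hrb, hb⟩ := exists_between hr.2
  have hb0 : 0 ≤ b := hr.1.trans hrb.le
  -- Clamping to `[0, b]` makes `f` continuous on the whole line without changing it on `[0, x]` for
  -- `x < b`.
  set F : ℝ → ℝ := fun t => f (max 0 (min t b)) with hF
  have hFc : Continuous F := by
    refine hf.comp_continuous (by fun_prop) fun t => ⟨le_max_left _ _, ?_⟩
    exact max_lt (by linarith) ((min_le_right _ _).trans_lt hb)
  have hc : Continuous fun x : ℝ => sSup ((fun t => F (x * t)) '' Icc 0 1) :=
    IsCompact.continuous_sSup (f := fun x t => F (x * t)) isCompact_Icc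
      (by exact hFc.comp (continuous_fst.mul continuous_snd))
  refine hc.continuousAt.continuousWithinAt.congr_of_eventuallyEq_of_mem ?_ hr
  filter_upwards [self_mem_nhdsWithin, mem_nhdsWithin_of_mem_nhds (Iio_mem_nhds hrb)] with x hx hxb
  congr 1
  have hxb' : x < b := hxb
  ext y
  constructor
  · rintro ⟨t, ht, rfl⟩
    rcases hx.1.eq_or_lt with h0 | h0
    · refine ⟨0, by simp, ?_⟩
      have : t = 0 := le_antisymm (h0 ▸ ht.2) ht.1
      simp [hF, this, hb0]
    · refine ⟨t / x, ⟨by have := ht.1; positivity, (div_le_one h0).2 ht.2⟩, ?_⟩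
      simp only [hF]
      rw [mul_div_cancel₀ _ h0.ne', min_eq_left (ht.2.trans hxb'.le), max_eq_right ht.1]
  · rintro ⟨t, ht, rfl⟩
    have h1 : x * t ≤ x := mul_le_of_le_one_right hx.1 ht.2
    have h2 : 0 ≤ x * t := mul_nonneg hx.1 ht.1
    refine ⟨x * t, ⟨h2, h1⟩, ?_⟩
    simp only [hF]
    rw [min_eq_left (h1.trans hxb'.le), max_eq_right h2]

end RunningMax

theorem hyperF₁_zero (n : ℕ) (α : ℝ) : hyperF₁ n α 0 = 1 := by simp [hyperF₁]

theorem hyperF₂_zero (n : ℕ) (α : ℝ) : hyperF₂ n α 0 = 1 := by simp [hyperF₂]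

theorem continuousOn_hyperF₂_mul_g {n : ℕ} (hn : 3 ≤ n) (α : ℝ) :
    ContinuousOn (fun t => hyperF₂ n α t * g n α t) (Ico 0 1) :=
  (continuousOn_hyperF₂ hn α).mul (continuousOn_g n α)

/-- The value at `t = 0` bounds the maximum below. With its two analogues it makes each term of `G`
nonnegative, as monotonicity requires. -/
theorem one_le_runningMax_hyperF₁ {n : ℕ} (hn : 3 ≤ n) (α : ℝ) {r : ℝ} (hr0 : 0 ≤ r) (hr1 : r < 1) :
    1 ≤ sSup (hyperF₁ n α '' Icc 0 r) := by
  simpa [hyperF₁_zero] using le_runningMax (continuousOn_hyperF₁ hn α) le_rfl hr0 hr1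

theorem one_le_runningMax_hyperF₂ {n : ℕ} (hn : 3 ≤ n) (α : ℝ) {r : ℝ} (hr0 : 0 ≤ r) (hr1 : r < 1) :
    1 ≤ sSup (hyperF₂ n α '' Icc 0 r) := by
  simpa [hyperF₂_zero] using le_runningMax (continuousOn_hyperF₂ hn α) le_rfl hr0 hr1

theorem le_runningMax_hyperF₂_mul_g {n : ℕ} (hn : 3 ≤ n) (α : ℝ) {r : ℝ} (hr0 : 0 ≤ r)
    (hr1 : r < 1) :
    (n : ℝ) + 2 - α ≤ sSup ((fun t => hyperF₂ n α t * g n α t) '' Icc 0 r) := by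
  simpa [hyperF₂_zero, g] using le_runningMax (continuousOn_hyperF₂_mul_g hn α) le_rfl hr0 hr1

theorem continuousOn_G {n : ℕ} (hn : 3 ≤ n) (α : ℝ) : ContinuousOn (G n α) (Ico 0 1) := by
  have h0 : ∀ r ∈ Ico (0 : ℝ) 1, 1 - r ^ 2 ≠ 0 := fun r hr => by nlinarith [hr.1, hr.2]
  have c1 : ContinuousOn (fun r : ℝ => 1 / (1 - r ^ 2)) (Ico 0 1) :=
    continuousOn_const.div (by fun_prop) h0
  have c2 : ContinuousOn (fun r : ℝ => 1 / (1 - r ^ 2) ^ 2) (Ico 0 1) :=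
    continuousOn_const.div (by fun_prop) fun r hr => pow_ne_zero _ (h0 r hr)
  have c3 : ContinuousOn (fun r : ℝ => 1 / (1 - r ^ 2) ^ (3 - α)) (Ico 0 1) := by
    refine continuousOn_const.div
      (ContinuousOn.rpow_const (by fun_prop) fun r hr => Or.inl (h0 r hr)) fun r hr => ?_
    exact (Real.rpow_pos_of_pos (by nlinarith [hr.1, hr.2]) _).ne'
  unfold G
  exact (((continuousOn_const.mul (continuousOn_runningMax (continuousOn_hyperF₁ hn α))).mul c1).add
    ((continuousOn_const.mul (continuousOn_runningMax (continuousOn_hyperF₂ hn α))).mul c2)).add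
    ((continuousOn_const.mul (continuousOn_runningMax (continuousOn_hyperF₂_mul_g hn α))).mul c3)

theorem preG_le_G {n : ℕ} (hn : 3 ≤ n) {α : ℝ} (hα : α < 1) {r : ℝ} (hr0 : 0 ≤ r) (hr1 : r < 1) :
    preG n α r ≤ G n α r := by
  have hn' : (3 : ℝ) ≤ n := by exact_mod_cast hn
  have hC := normConst_pos hn hα
  have h0 : 0 < 1 - r ^ 2 := by nlinarith
  have hnα : 0 < (n : ℝ) - α := by linarith
  have hα' : 0 < 1 - α := by linarith
  have m1 := le_runningMax (continuousOn_hyperF₁ hn α) hr0 le_rfl hr1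
  have m2 := le_runningMax (continuousOn_hyperF₂ hn α) hr0 le_rfl hr1
  have m3 := le_runningMax (continuousOn_hyperF₂_mul_g hn α) hr0 le_rfl hr1
  rw [preG, G]
  gcongr

theorem G_mono {n : ℕ} (hn : 3 ≤ n) {α : ℝ} (hα : α < 1) {r s : ℝ} (hr0 : 0 ≤ r) (hrs : r ≤ s)
    (hs1 : s < 1) : G n α r ≤ G n α s := by
  have hn' : (3 : ℝ) ≤ n := by exact_mod_cast hn
  have hC := normConst_pos hn hα
  have hs0 : 0 < 1 - s ^ 2 := by nlinarith
  have hsr : 1 - s ^ 2 ≤ 1 - r ^ 2 := by nlinarith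
  have hnα : 0 < (n : ℝ) - α := by linarith
  have hα' : 0 < 1 - α := by linarith
  have hα3 : 0 ≤ 3 - α := by linarith
  have m1 := runningMax_mono (continuousOn_hyperF₁ hn α) hr0 hrs hs1
  have m2 := runningMax_mono (continuousOn_hyperF₂ hn α) hr0 hrs hs1
  have m3 := runningMax_mono (continuousOn_hyperF₂_mul_g hn α) hr0 hrs hs1
  have n1 := one_le_runningMax_hyperF₁ hn α (hr0.trans hrs) hs1
  have n2 := one_le_runningMax_hyperF₂ hn α (hr0.trans hrs) hs1
  have n3 := le_runningMax_hyperF₂_mul_g hn α (hr0.trans hrs) hs1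
  have q1 : 0 ≤ sSup (hyperF₁ n α '' Icc 0 s) := by linarith
  have q2 : 0 ≤ sSup (hyperF₂ n α '' Icc 0 s) := by linarith
  have q3 : 0 ≤ sSup ((fun t => hyperF₂ n α t * g n α t) '' Icc 0 s) := by linarith
  have hr2 : 0 < 1 - r ^ 2 := by linarith
  rw [G, G]
  refine add_le_add (add_le_add ?_ ?_) ?_
  · exact mul_le_mul (mul_le_mul_of_nonneg_left m1 (by positivity))
      (one_div_le_one_div_of_le hs0 hsr) (by positivity) (by positivity)
  · exact mul_le_mul (mul_le_mul_of_nonneg_left m2 (by positivity))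
      (one_div_le_one_div_of_le (by positivity) (by gcongr)) (by positivity) (by positivity)
  · exact mul_le_mul (mul_le_mul_of_nonneg_left m3 (by positivity))
      (one_div_le_one_div_of_le (by positivity) (by gcongr)) (by positivity) (by positivity)

/-- The second term alone, with its square weakened, already forces `r G(r)` to be unbounded near
`1`. -/
theorem le_G {n : ℕ} (hn : 3 ≤ n) {α : ℝ} (hα : α < 1) {r : ℝ} (hr0 : 0 ≤ r) (hr1 : r < 1) :
    ((n : ℝ) - α) * normConst n α / (1 - r ^ 2) ≤ G n α r := by
  have hn' : (3 : ℝ) ≤ n := by exact_mod_cast hn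
  have hC := normConst_pos hn hα
  have h0 : 0 < 1 - r ^ 2 := by nlinarith
  have hnα : 0 < (n : ℝ) - α := by linarith
  have hα' : 0 < 1 - α := by linarith
  have n1 := one_le_runningMax_hyperF₁ hn α hr0 hr1
  have n2 := one_le_runningMax_hyperF₂ hn α hr0 hr1
  have n3 := le_runningMax_hyperF₂_mul_g hn α hr0 hr1
  have t1 : 0 ≤ 2 * (1 - α) * normConst n α * sSup (hyperF₁ n α '' Icc 0 r) * (1 / (1 - r ^ 2)) := by
    positivity
  have t3 : 0 ≤ ((n : ℝ) - α) * normConst n α *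
      sSup ((fun t => hyperF₂ n α t * g n α t) '' Icc 0 r) * (1 / (1 - r ^ 2) ^ (3 - α)) := by
    have : 0 ≤ sSup ((fun t => hyperF₂ n α t * g n α t) '' Icc 0 r) := by linarith
    positivity
  have t2 : ((n : ℝ) - α) * normConst n α * 1 * (1 / (1 - r ^ 2)) ≤ ((n : ℝ) - α) * normConst n α *
      sSup (hyperF₂ n α '' Icc 0 r) * (1 / (1 - r ^ 2) ^ 2) := by
    have : 1 / (1 - r ^ 2) ≤ 1 / (1 - r ^ 2) ^ 2 :=
      one_div_le_one_div_of_le (by positivity) (by nlinarith [sq_nonneg r])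
    gcongr
  rw [G, div_eq_mul_one_div]
  linarith

theorem G_pos {n : ℕ} (hn : 3 ≤ n) {α : ℝ} (hα : α < 1) {r : ℝ} (hr0 : 0 ≤ r) (hr1 : r < 1) :
    0 < G n α r := by
  have hn' : (3 : ℝ) ≤ n := by exact_mod_cast hn
  have hC := normConst_pos hn hα
  have h0 : 0 < 1 - r ^ 2 := by nlinarith
  have hnα : 0 < (n : ℝ) - α := by linarith
  exact lt_of_lt_of_le (by positivity) (le_G hn hα hr0 hr1)

theorem mul_G_strictMono {n : ℕ} (hn : 3 ≤ n) {α : ℝ} (hα : α < 1) {r s : ℝ} (hr0 : 0 ≤ r)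
    (hrs : r < s) (hs1 : s < 1) : r * G n α r < s * G n α s :=
  calc r * G n α r ≤ r * G n α s := mul_le_mul_of_nonneg_left (G_mono hn hα hr0 hrs.le hs1) hr0
    _ < s * G n α s := mul_lt_mul_of_pos_right hrs (G_pos hn hα (hr0.trans hrs.le) hs1)

/-- The map `r ↦ r G(r)` takes every positive value on `(0, 1)`. -/
theorem exists_mul_G_eq {n : ℕ} (hn : 3 ≤ n) {α : ℝ} (hα : α < 1) {c : ℝ} (hc : 0 < c) :
    ∃ r, 0 < r ∧ r < 1 ∧ r * G n α r = c := by
  have hn' : (3 : ℝ) ≤ n := by exact_mod_cast hn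
  have hC := normConst_pos hn hα
  have hnα : 0 < (n : ℝ) - α := by linarith
  set D := ((n : ℝ) - α) * normConst n α with hD
  have hD0 : 0 < D := by positivity
  -- Since `1 - (1 - δ)² ≤ 2δ`, the choice `δ ≤ D / (4c)` gives `G (1 - δ) ≥ 2c`, and `δ ≤ 1 / 2`
  -- loses at most a factor `2`.
  set δ := min (1 / 2) (D / (4 * c)) with hδ
  have hδ0 : 0 < δ := lt_min (by norm_num) (by positivity)
  have hδ1 : δ ≤ 1 / 2 := min_le_left _ _
  have hδ2 : δ ≤ D / (4 * c) := min_le_right _ _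
  have hlow := le_G hn hα (r := 1 - δ) (by linarith) (by linarith)
  have hbig : c ≤ (1 - δ) * G n α (1 - δ) := by
    have h0 : 0 < 1 - (1 - δ) ^ 2 := by nlinarith
    have h1 : 2 * c ≤ D / (1 - (1 - δ) ^ 2) := by
      rw [le_div_iff₀ h0]
      rw [le_div_iff₀ (by positivity)] at hδ2
      nlinarith [mul_pos hc (sq_pos_of_pos hδ0)]
    nlinarith
  have hcont : ContinuousOn (fun r => r * G n α r) (Icc 0 (1 - δ)) :=
    continuousOn_id.mul ((continuousOn_G hn α).mono fun r hr => ⟨hr.1, by linarith [hr.2]⟩)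
  obtain ⟨r, hr, hrc⟩ := intermediate_value_Icc (by linarith : (0 : ℝ) ≤ 1 - δ) hcont
    (show c ∈ Icc ((0 : ℝ) * G n α 0) ((1 - δ) * G n α (1 - δ)) from ⟨by rw [zero_mul]; exact hc.le, hbig⟩)
  refine ⟨r, lt_of_le_of_ne hr.1 ?_, by linarith [hr.2], hrc⟩
  rintro rfl
  simp only [zero_mul] at hrc
  exact hc.ne hrc

/-! ### A lower bound from the determinant -/

/-- A consequence of Hadamard's inequality. -/
theorem abs_det_le_norm_apply_mul {n : ℕ} (hn : 0 < n) (A : (𝔼 n) →L[ℝ] 𝔼 n) {v : 𝔼 n}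
    (hv : ‖v‖ = 1) : |A.det| ≤ ‖A v‖ * ‖A‖ ^ (n - 1) := by
  set i : Fin n := ⟨0, hn⟩
  obtain ⟨b, hbi⟩ := exists_orthonormalBasis_apply_eq i hv
  have : Fact (Module.finrank ℝ (𝔼 n) = n) := ⟨by simp⟩
  -- Hadamard's inequality for the images of an orthonormal basis containing `v`; the other `n - 1`
  -- factors are at most `‖A‖`.
  have h1 := b.toBasis.orientation.abs_volumeForm_apply_le (A ∘ b)
  rw [Orientation.volumeForm_robust' _ b] at h1
  have h2 := b.toBasis.det_comp (A : (𝔼 n) →ₗ[ℝ] 𝔼 n) b.toBasis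
  rw [Module.Basis.det_self, mul_one, OrthonormalBasis.coe_toBasis] at h2
  have h3 : |A.det| = |b.toBasis.det (A ∘ b)| := congrArg abs h2.symm
  rw [h3]
  refine h1.trans ?_
  rw [← Finset.mul_prod_erase _ _ (Finset.mem_univ i), Function.comp_apply, hbi]
  gcongr
  calc ∏ j ∈ Finset.univ.erase i, ‖(A ∘ b) j‖ ≤ ∏ _j ∈ Finset.univ.erase i, ‖A‖ :=
        Finset.prod_le_prod (fun _ _ => norm_nonneg _) fun j _ => by
          simpa using A.le_opNorm (b j)
    _ = ‖A‖ ^ (n - 1) := by simp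

/-! ### A quantitative inverse function theorem -/

section Landau

variable {E : Type*} [NormedAddCommGroup E] [NormedSpace ℝ E] {u : E → E} {D : E → E →L[ℝ] E}
  {K r₀ : ℝ}

theorem norm_sub_sub_le_of_deriv (hD : ∀ x, ‖x‖ < r₀ → HasFDerivAt u (D x) x)
    (hK : 0 ≤ K) (hDK : ∀ x, ‖x‖ < r₀ → ‖D x - D 0‖ ≤ K * ‖x‖) {ρ : ℝ} (hρ : ρ < r₀) {x y : E}
    (hx : ‖x‖ ≤ ρ) (hy : ‖y‖ ≤ ρ) : ‖u y - u x - D 0 (y - x)‖ ≤ K * ρ * ‖y - x‖ := by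
  refine Convex.norm_image_sub_le_of_norm_hasFDerivWithin_le' (s := closedBall (0 : E) ρ)
    (f' := D) (fun z hz => ?_) (fun z hz => ?_) (convex_closedBall _ _)
    (mem_closedBall_zero_iff.2 hx) (mem_closedBall_zero_iff.2 hy)
  · exact (hD z ((mem_closedBall_zero_iff.1 hz).trans_lt hρ)).hasFDerivWithinAt
  · have hz' := mem_closedBall_zero_iff.1 hz
    exact (hDK z (hz'.trans_lt hρ)).trans (mul_le_mul_of_nonneg_left hz' hK)

/-- Along the segment to `x` the deviation of the derivative grows linearly in `t`; integrating it
gains the factor `1 / 2` over the mean value bound. -/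
theorem norm_sub_apply_le_of_deriv (hD : ∀ x, ‖x‖ < r₀ → HasFDerivAt u (D x) x)
    (hDK : ∀ x, ‖x‖ < r₀ → ‖D x - D 0‖ ≤ K * ‖x‖) (hu0 : u 0 = 0) {x : E} (hx : ‖x‖ < r₀) :
    ‖u x - D 0 x‖ ≤ K * ‖x‖ ^ 2 / 2 := by
  have hlt : ∀ t ∈ Icc (0 : ℝ) 1, ‖t • x‖ < r₀ := fun t ht => by
    rw [norm_smul, Real.norm_eq_abs, abs_of_nonneg ht.1]
    exact (mul_le_of_le_one_left (norm_nonneg _) ht.2).trans_lt hx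
  have hder : ∀ t ∈ Icc (0 : ℝ) 1,
      HasDerivAt (fun t : ℝ => u (t • x) - t • D 0 x) ((D (t • x) - D 0) x) t := by
    intro t ht
    have h1 : HasDerivAt (fun t : ℝ => t • x) x t := by
      simpa using (hasDerivAt_id t).smul_const x
    have h2 : HasDerivAt (fun t : ℝ => t • D 0 x) (D 0 x) t := by
      simpa using (hasDerivAt_id t).smul_const (D 0 x)
    exact ((hD _ (hlt t ht)).comp_hasDerivAt t h1).sub h2
  have hB : ∀ t : ℝ, HasDerivAt (fun t : ℝ => K * ‖x‖ ^ 2 / 2 * t ^ 2) (K * ‖x‖ ^ 2 * t) t := by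
    intro t
    refine ((hasDerivAt_pow 2 t).const_mul (K * ‖x‖ ^ 2 / 2)).congr_deriv ?_
    push_cast; ring
  have h := image_norm_le_of_norm_deriv_right_le_deriv_boundary
    (f := fun t : ℝ => u (t • x) - t • D 0 x) (a := 0) (b := 1)
    (fun t ht => (hder t ht).continuousAt.continuousWithinAt)
    (fun t ht => (hder t ⟨ht.1, ht.2.le⟩).hasDerivWithinAt) (by simp [hu0]) hB (fun t ht => by
      have ht' : t ∈ Icc (0 : ℝ) 1 := ⟨ht.1, ht.2.le⟩
      calc ‖(D (t • x) - D 0) x‖ ≤ ‖D (t • x) - D 0‖ * ‖x‖ := ContinuousLinearMap.le_opNorm _ _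
        _ ≤ K * ‖t • x‖ * ‖x‖ := by gcongr; exact hDK _ (hlt t ht')
        _ = K * ‖x‖ ^ 2 * t := by
          rw [norm_smul, Real.norm_eq_abs, abs_of_nonneg ht.1]; ring)
    (right_mem_Icc.2 zero_le_one)
  simpa using h

/-- If `u x = u y`, the mean value bound uses the radius `max ‖x‖ ‖y‖ < r₀` and contradicts the
lower bound with `r₀`. -/
theorem injOn_ball_of_deriv (hD : ∀ x, ‖x‖ < r₀ → HasFDerivAt u (D x) x) (hK : 0 < K)
    (hDK : ∀ x, ‖x‖ < r₀ → ‖D x - D 0‖ ≤ K * ‖x‖) (hlow : ∀ x, K * r₀ * ‖x‖ ≤ ‖D 0 x‖) :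
    InjOn u (ball 0 r₀) := by
  intro x hx y hy hxy
  rw [mem_ball_zero_iff] at hx hy
  by_contra hne
  have h := norm_sub_sub_le_of_deriv hD hK.le hDK (max_lt hx hy) (le_max_left ‖x‖ ‖y‖)
    (le_max_right ‖x‖ ‖y‖)
  rw [hxy, sub_self, zero_sub, norm_neg] at h
  have hpos : 0 < ‖y - x‖ := norm_pos_iff.2 (sub_ne_zero.2 (Ne.symm hne))
  have h1 := (hlow (y - x)).trans h
  have h2 := mul_lt_mul_of_pos_right (mul_lt_mul_of_pos_left (max_lt hx hy) hK) hpos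
  linarith

/-- For `ρ < r₀` the image of the `ρ`-ball is open, and on the sphere of radius `ρ` one has `‖u x‖ ≥
K r₀ ρ - K ρ² / 2`. The connected ball of that radius meets the image at `0` and cannot leave it. -/
theorem ball_subset_image_of_deriv [FiniteDimensional ℝ E]
    (hD : ∀ x, ‖x‖ < r₀ → HasFDerivAt u (D x) x) (hK : 0 < K) (hr₀ : 0 < r₀)
    (hDK : ∀ x, ‖x‖ < r₀ → ‖D x - D 0‖ ≤ K * ‖x‖) (hlow : ∀ x, K * r₀ * ‖x‖ ≤ ‖D 0 x‖)
    (hu0 : u 0 = 0) : ball (0 : E) (K * r₀ ^ 2 / 2) ⊆ u '' ball 0 r₀ := by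
  intro w hw
  rw [mem_ball_zero_iff] at hw
  -- As `ρ` increases to `r₀`, the radius `K r₀ ρ - K ρ² / 2` tends to `K r₀² / 2 > ‖w‖`.
  obtain ⟨ρ, hρ0, hρ1, hwρ⟩ : ∃ ρ, 0 < ρ ∧ ρ < r₀ ∧ ‖w‖ < K * r₀ * ρ - K * ρ ^ 2 / 2 := by
    have hc : Filter.Tendsto (fun ρ : ℝ => K * r₀ * ρ - K * ρ ^ 2 / 2) (nhdsWithin r₀ (Iio r₀))
        (nhds (K * r₀ * r₀ - K * r₀ ^ 2 / 2)) :=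
      (Continuous.tendsto (by fun_prop) r₀).mono_left nhdsWithin_le_nhds
    have h1 := hc.eventually (lt_mem_nhds (show ‖w‖ < K * r₀ * r₀ - K * r₀ ^ 2 / 2 by nlinarith))
    obtain ⟨ρ, h, h'⟩ := (h1.and (Ioo_mem_nhdsLT hr₀)).exists
    exact ⟨ρ, h'.1, h'.2, h⟩
  set R := K * r₀ * ρ - K * ρ ^ 2 / 2 with hR
  have : CompleteSpace E := FiniteDimensional.complete ℝ E
  have : ProperSpace E := FiniteDimensional.proper ℝ E
  have hinj : Function.Injective (D 0 : E →ₗ[ℝ] E) := by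
    rw [← LinearMap.ker_eq_bot, LinearMap.ker_eq_bot']
    intro x hx
    have := hlow x
    rw [show D 0 x = 0 from hx, norm_zero] at this
    exact norm_le_zero_iff.1 (nonpos_of_mul_nonpos_right this (by positivity))
  have hsurj : Function.Surjective (D 0 : E →ₗ[ℝ] E) := LinearMap.surjective_of_injective hinj
  choose inv hinv using hsurj
  -- On this ball `u` is approximated by `D 0` with constant `K ρ`, less than `K r₀`, the reciprocal
  -- of the bound for the inverse of `D 0`.
  have hopen : IsOpen (u '' ball 0 ρ) := by
    have happ : ApproximatesLinearOn u (D 0) (ball 0 ρ) ⟨K * ρ, by positivity⟩ := by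
      intro x hx y hy
      exact norm_sub_sub_le_of_deriv hD hK.le hDK hρ1 (mem_ball_zero_iff.1 hy).le
        (mem_ball_zero_iff.1 hx).le
    refine happ.open_image ⟨inv, ⟨(K * r₀)⁻¹, by positivity⟩, fun y => ?_, hinv⟩ isOpen_ball
      (Or.inr ?_)
    · have := hlow (inv y)
      rw [show D 0 (inv y) = y from hinv y] at this
      change ‖inv y‖ ≤ (K * r₀)⁻¹ * ‖y‖
      rwa [inv_mul_eq_div, le_div_iff₀' (by positivity)]
    · refine NNReal.coe_lt_coe.1 ?_
      change K * ρ < ((K * r₀)⁻¹)⁻¹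
      rw [inv_inv]
      gcongr
  have hclosed : closure (u '' ball 0 ρ) ⊆ u '' closedBall 0 ρ := by
    refine closure_minimal (image_mono ball_subset_closedBall) ?_
    refine ((isCompact_closedBall (0 : E) ρ).image_of_continuousOn fun x hx => ?_).isClosed
    exact (hD x ((mem_closedBall_zero_iff.1 hx).trans_lt hρ1)).continuousAt.continuousWithinAt
  have hsub : ball (0 : E) R ⊆ u '' ball 0 ρ := by
    refine (convex_ball (0 : E) R).isPreconnected.subset_of_closure_inter_subset hopen ?_ ?_
    · exact ⟨0, mem_ball_self ((norm_nonneg w).trans_lt hwρ), 0, mem_ball_self hρ0, hu0⟩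
    · rintro y ⟨hy, hyR⟩
      obtain ⟨x, hx, rfl⟩ := hclosed hy
      rw [mem_closedBall_zero_iff] at hx
      refine ⟨x, mem_ball_zero_iff.2 (lt_of_le_of_ne hx fun hxe => ?_), rfl⟩
      -- A limit point reached from the boundary sphere would have norm at least `R`.
      have h1 := norm_sub_apply_le_of_deriv hD hDK hu0 (hx.trans_lt hρ1)
      have h2 := hlow x
      have h3 : ‖D 0 x‖ ≤ ‖u x‖ + ‖u x - D 0 x‖ := by
        have := norm_sub_le (u x) (u x - D 0 x)
        rwa [sub_sub_cancel] at this
      rw [mem_ball_zero_iff] at hyR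
      rw [hxe] at h1 h2
      linarith
  obtain ⟨x, hx, rfl⟩ := hsub (mem_ball_zero_iff.2 hwρ)
  exact ⟨x, ball_subset_ball hρ1.le hx, rfl⟩

end Landau

end AlphaHarmonic

end

/-! ### Assembly of the Landau-type theorem -/

theorem theorem1p3 (n : ℕ) (hn : 3 ≤ n) (α : ℝ) (hα : α < 1) (M : ℝ) (hM : 0 < M)
    (φ : Metric.sphere (0 : EuclideanSpace ℝ (Fin n)) 1 → EuclideanSpace ℝ (Fin n))
    (hφ : MeasureTheory.MemLp φ ⊤ (AlphaHarmonic.sphereMeasure n))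
    (hφM : MeasureTheory.eLpNorm φ ⊤ (AlphaHarmonic.sphereMeasure n) ≤ ENNReal.ofReal M)
    (u : EuclideanSpace ℝ (Fin n) → EuclideanSpace ℝ (Fin n))
    (hu : ∀ x ∈ Metric.ball (0 : EuclideanSpace ℝ (Fin n)) 1,
      u x = AlphaHarmonic.poissonIntegral α φ x)
    (hu0 : u 0 = 0) (hJ : AlphaHarmonic.jacobian u 0 = 1) :
    ∃ r₀ : ℝ,
      IsLeast {r : ℝ | 0 < r ∧ r < 1 ∧
        M ^ n * r * AlphaHarmonic.G n α r =
          (Real.sqrt Real.pi * Real.Gamma (((n : ℝ) + 1) / 2) /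
            (((n : ℝ) - α) * AlphaHarmonic.normConst n α * Real.Gamma ((n : ℝ) / 2))) ^ (n - 1)}
        r₀ ∧
      Set.InjOn u (Metric.ball 0 r₀) ∧
      Metric.ball (0 : EuclideanSpace ℝ (Fin n)) (M / 2 * r₀ ^ 2 * AlphaHarmonic.G n α r₀) ⊆
        u '' Metric.ball 0 r₀ := by
  have : NeZero n := ⟨by omega⟩
  have hn' : (3 : ℝ) ≤ n := by exact_mod_cast hn
  have hC := AlphaHarmonic.normConst_pos hn hα
  have hG1 : 0 < Real.Gamma ((n : ℝ) / 2) := Real.Gamma_pos_of_pos (by linarith)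
  have hG2 : 0 < Real.Gamma (((n : ℝ) + 1) / 2) := Real.Gamma_pos_of_pos (by linarith)
  have hnα : 0 < (n : ℝ) - α := by linarith
  set c := Real.sqrt Real.pi * Real.Gamma (((n : ℝ) + 1) / 2) /
    (((n : ℝ) - α) * AlphaHarmonic.normConst n α * Real.Gamma ((n : ℝ) / 2)) with hc
  have hc0 : 0 < c := by positivity
  obtain ⟨r₀, hr0, hr1, hr⟩ := AlphaHarmonic.exists_mul_G_eq hn hα
    (c := c ^ (n - 1) / M ^ n) (by positivity)
  have hroot : M ^ n * r₀ * AlphaHarmonic.G n α r₀ = c ^ (n - 1) := by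
    rw [mul_assoc, hr, mul_div_cancel₀ _ (by positivity)]
  have hb := AlphaHarmonic.ae_norm_le hM.le hφM
  have hD : ∀ x : EuclideanSpace ℝ (Fin n), ‖x‖ < r₀ →
      HasFDerivAt u (AlphaHarmonic.poissonDeriv α φ x) x := by
    intro x hx
    have hx1 : ‖x‖ < 1 := hx.trans hr1
    refine (AlphaHarmonic.hasFDerivAt_poissonIntegral α hφ.1 hb hx1).congr_of_eventuallyEq ?_
    filter_upwards [Metric.isOpen_ball.mem_nhds (mem_ball_zero_iff.2 hx1)] with y hy using hu y hy
  have hdet : (AlphaHarmonic.poissonDeriv α φ 0).det = 1 := by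
    rw [← (hD 0 (by simpa using hr0)).fderiv]
    exact hJ
  have hnorm : ‖AlphaHarmonic.poissonDeriv α φ 0‖ ≤ M / c := by
    refine (AlphaHarmonic.norm_poissonDeriv_zero_le hn hα hM.le hφ.1 hb).trans_eq ?_
    rw [hc, div_div_eq_mul_div]
    ring
  have hGpos := AlphaHarmonic.G_pos hn hα hr0.le hr1
  set K := M * AlphaHarmonic.G n α r₀ with hK
  have hK0 : 0 < K := by positivity
  -- The equation for `r₀`, rewritten as the equality of the Lipschitz bound at radius `r₀` with the
  -- lower bound for `Du(0)`.
  have hKr : K * r₀ = (c / M) ^ (n - 1) := by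
    have e : M ^ n = M ^ (n - 1) * M := by
      rw [← pow_succ, Nat.sub_add_cancel (by omega)]
    rw [div_pow, eq_div_iff (by positivity), ← hroot, e, hK]
    ring
  have hunit : ∀ v : EuclideanSpace ℝ (Fin n), ‖v‖ = 1 →
      K * r₀ ≤ ‖AlphaHarmonic.poissonDeriv α φ 0 v‖ := by
    intro v hv
    -- With determinant `1`, the bound `‖Du(0)‖ ≤ M / c` yields the lower bound on `Du(0) v`.
    have h := AlphaHarmonic.abs_det_le_norm_apply_mul (by omega) (AlphaHarmonic.poissonDeriv α φ 0) hv
    rw [hdet, abs_one] at h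
    have h1 : 1 ≤ ‖AlphaHarmonic.poissonDeriv α φ 0 v‖ * (M / c) ^ (n - 1) :=
      h.trans (by gcongr)
    rw [hKr, ← inv_div M c, inv_pow, inv_le_iff_one_le_mul₀ (by positivity)]
    exact h1
  have hlow : ∀ x : EuclideanSpace ℝ (Fin n), K * r₀ * ‖x‖ ≤ ‖AlphaHarmonic.poissonDeriv α φ 0 x‖ := by
    intro x
    rcases eq_or_ne x 0 with rfl | hx
    · simp
    have hx0 : 0 < ‖x‖ := norm_pos_iff.2 hx
    have h := hunit (‖x‖⁻¹ • x) (by rw [norm_smul, norm_inv, norm_norm, inv_mul_cancel₀ hx0.ne'])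
    rw [map_smul, norm_smul, norm_inv, norm_norm, inv_mul_eq_div, le_div_iff₀ hx0] at h
    exact h
  have hDK : ∀ x : EuclideanSpace ℝ (Fin n), ‖x‖ < r₀ →
      ‖AlphaHarmonic.poissonDeriv α φ x - AlphaHarmonic.poissonDeriv α φ 0‖ ≤ K * ‖x‖ := by
    intro x hx
    refine (AlphaHarmonic.norm_poissonDeriv_sub_le hn hα hM.le hφ.1 hb (hx.trans hr1)).trans ?_
    have h1 := (AlphaHarmonic.preG_le_G hn hα (norm_nonneg x) (hx.trans hr1)).trans
      (AlphaHarmonic.G_mono hn hα (norm_nonneg x) hx.le hr1)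
    calc M * (‖x‖ * AlphaHarmonic.preG n α ‖x‖) ≤ M * (‖x‖ * AlphaHarmonic.G n α r₀) := by gcongr
      _ = K * ‖x‖ := by rw [hK]; ring
  refine ⟨r₀, ⟨⟨hr0, hr1, hroot⟩, fun s hs => ?_⟩,
    AlphaHarmonic.injOn_ball_of_deriv hD hK0 hDK hlow, ?_⟩
  -- Strict monotonicity of `r G(r)` excludes a smaller root.
  · by_contra hlt
    have h := AlphaHarmonic.mul_G_strictMono hn hα hs.1.le (not_le.1 hlt) hr1
    have h1 := hs.2.2
    rw [← hroot, mul_assoc, mul_assoc] at h1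
    exact h.ne (mul_left_cancel₀ (by positivity) h1)
  · have h := AlphaHarmonic.ball_subset_image_of_deriv hD hK0 hr0 hDK hlow hu0
    rwa [show M / 2 * r₀ ^ 2 * AlphaHarmonic.G n α r₀ = K * r₀ ^ 2 / 2 by rw [hK]; ring]
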